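/- Let $f$ be a transcendental (i.e. non-rational) meromorphic function in the complex plane $\mathbf{C}$, regarded as a map into the Riemann sphere $\overline{\mathbf{C}}=\mathbf{C}\cup\{\infty\}$. A critical point of $f$ is a point at which $f'$ vanishes or a multiple pole of $f$, and a critical value is the image $f(z)\in\overline{\mathbf{C}}$ of a critical point $z$. A point $a\in\overline{\mathbf{C}}$ is an asymptotic value of $f$ if there is a curve $\gamma:[0,\infty)\to\mathbf{C}$ with $\gamma(t)\to\infty$ and $f(\gamma(t))\to a$ as $t\to\infty$. A singular value is a critical value or an asymptotic value. Let $T(r,f)$ denote the Nevanlinna characteristic of $f$. If $f$ has only finitely many singular values and at least one of them is an asymptotic value, then $$\liminf_{r\to\infty}\frac{T(r,f)}{\sqrt r}>0$$ (the lower limit may be $+\infty$). In particular, this inequality holds for every transcendental entire function with finitely many singular values. -/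

import Mathlib

open Filter Topology

namespace SingularValues

/-- The map from the plane to the Riemann sphere `OnePoint ℂ` defined by a meromorphic function
`f`: its value at `z` is the limit of `f` at `z`, which is `∞` exactly when `z` is a pole. It does
not depend on the values that `f : ℂ → ℂ` takes at poles and removable singularities. -/
noncomputable def sphereMap (f : ℂ → ℂ) (z : ℂ) : OnePoint ℂ :=
  limUnder (𝓝[≠] z) (fun w => (f w : OnePoint ℂ))

/-- `z` is a critical point of the meromorphic function `f`: either `f` is regular at `z` and its
derivative vanishes there, or `z` is a multiple pole. -/
def IsCriticalPoint (f : ℂ → ℂ) (z : ℂ) : Prop :=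
  (0 ≤ meromorphicOrderAt f z ∧ 0 < meromorphicOrderAt (deriv f) z) ∨
    meromorphicOrderAt f z ≤ (-2 : ℤ)

/-- Critical values are the images, in the Riemann sphere, of critical points. -/
def IsCriticalValue (f : ℂ → ℂ) (a : OnePoint ℂ) : Prop :=
  ∃ z : ℂ, IsCriticalPoint f z ∧ sphereMap f z = a

/-- `a` is an asymptotic value of `f`: there is a curve in the plane tending to infinity along which
`f` tends to `a` in the Riemann sphere. -/
def IsAsymptoticValue (f : ℂ → ℂ) (a : OnePoint ℂ) : Prop :=
  ∃ γ : ℝ → ℂ, ContinuousOn γ (Set.Ici 0) ∧ Tendsto γ atTop (cocompact ℂ) ∧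
    Tendsto (fun t => sphereMap f (γ t)) atTop (𝓝 a)

/-- The set of singular values in the Riemann sphere. -/
def singularValues (f : ℂ → ℂ) : Set (OnePoint ℂ) :=
  {a | IsCriticalValue f a ∨ IsAsymptoticValue f a}

/-- `f` is, as a meromorphic function (that is, off a closed discrete set), a rational function. -/
def IsRational (f : ℂ → ℂ) : Prop :=
  ∃ p q : Polynomial ℂ, q ≠ 0 ∧ f =ᶠ[codiscrete ℂ] fun z => p.eval z / q.eval z

/-- Transcendental meromorphic functions in the plane. -/
def IsTranscendentalMeromorphic (f : ℂ → ℂ) : Prop :=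
  Meromorphic f ∧ ¬ IsRational f

/-- The lower limit of `T(r, f) / √r` as `r → ∞`, in the extended reals, where `T(r, f)` is the
Nevanlinna characteristic. -/
noncomputable def lowerGrowth (f : ℂ → ℂ) : EReal :=
  liminf (fun r : ℝ => ((ValueDistribution.characteristic f ⊤ r / Real.sqrt r : ℝ) : EReal)) atTop

end SingularValues

/-!
After a Möbius change of variable the asymptotic value may be taken to be `∞`. Since `∞` is an
isolated point of the set of singular values, `F` has none in some `exp L < |w| < ∞`, so path
lifting gives a branch `ψ` of `F⁻¹ ∘ exp` on the half plane `Re ζ > L`. Were `ψ` not univalent it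
would be periodic, and its tract would fill a punctured neighbourhood of `∞` or of a pole of `F`:
the former makes `F` rational, the latter contradicts the asymptotic curve. A univalent `ψ` which
omits a disc satisfies `‖ψ (L' + x)‖ ≤ C * (1 + x) ^ 2`, a growth estimate of Koebe type obtained
by bounding the logarithmic area of the images of discs. Finally `log ‖F‖ - L'`, extended by zero
off the tract, is subharmonic, so its value `x` at `ψ (L' + x)` is by Harnack's inequality at most
three times its mean over the circle of radius `r = 2 * ‖ψ (L' + x)‖`, which is at most the
proximity function `m(r, F)`. Hence `m(r, F)` is at least of order `x ≥ c * √r`.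
-/

namespace SingularValues

open MeasureTheory Metric Set
open scoped ComplexConjugate Real

/-! ### Growth of univalent functions on a disc -/

theorem setIntegral_annulus_eq_setIntegral_prod {E : Type*} [NormedAddCommGroup E]
    [NormedSpace ℝ E] (φ : ℂ → E) {a : ℝ} (b : ℝ) (ha : 0 ≤ a) :
    ∫ z in {z : ℂ | ‖z‖ ∈ Ioo a b}, φ z =
      ∫ p in Ioo a b ×ˢ Ioo (-π) π, p.1 • φ (circleMap 0 p.1 p.2) := by
  have hpolar (p : ℝ × ℝ) : Complex.polarCoord.symm p = circleMap 0 p.1 p.2 := by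
    simp [Complex.polarCoord_symm_apply, circleMap, Complex.exp_mul_I]
  have hmeas : MeasurableSet {z : ℂ | ‖z‖ ∈ Ioo a b} := measurableSet_Ioo.preimage measurable_norm
  rw [← integral_indicator hmeas, ← Complex.integral_comp_polarCoord_symm,
    ← integral_indicator (measurableSet_Ioo.prod measurableSet_Ioo),
    ← integral_indicator polarCoord.open_target.measurableSet]
  congr 1
  ext ⟨ρ, θ⟩
  simp only [indicator, polarCoord_target, mem_prod, hpolar, mem_ofPred_eq, norm_circleMap_zero]
  by_cases hρ : 0 < ρ
  · rw [abs_of_pos hρ]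
    simp only [mem_Ioi, hρ, true_and]
    split_ifs <;> simp_all
  · have : ρ ∉ Ioo a b := fun h => hρ (ha.trans_lt h.1)
    simp [hρ, this]

theorem setIntegral_circleMap_eq_smul_circleAverage {E : Type*} [NormedAddCommGroup E]
    [NormedSpace ℝ E] (φ : ℂ → E) (ρ : ℝ) :
    ∫ θ in Ioo (-π) π, φ (circleMap 0 ρ θ) = (2 * π) • Real.circleAverage φ 0 ρ := by
  have hperiod := ((periodic_circleMap 0 ρ).comp φ).intervalIntegral_add_eq (-π) 0
  simp only [Function.comp_apply, zero_add, show -π + 2 * π = π by ring] at hperiod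
  rw [← integral_Ioc_eq_integral_Ioo,
    ← intervalIntegral.integral_of_le (by linarith [Real.pi_pos]), hperiod,
    Real.circleAverage_def, smul_inv_smul₀ (by positivity)]

theorem setIntegral_annulus_eq {E : Type*} [NormedAddCommGroup E] [NormedSpace ℝ E]
    {φ : ℂ → E} {a b : ℝ} (ha : 0 ≤ a) (hab : a ≤ b)
    (hφ : ContinuousOn φ {z | ‖z‖ ∈ Icc a b}) :
    ∫ z in {z : ℂ | ‖z‖ ∈ Ioo a b}, φ z =
      ∫ ρ in a..b, (2 * π * ρ) • Real.circleAverage φ 0 ρ := by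
  have hcircleMap : Continuous fun p : ℝ × ℝ => circleMap 0 p.1 p.2 := by
    unfold circleMap
    fun_prop
  have hcont : ContinuousOn (fun p : ℝ × ℝ => p.1 • φ (circleMap 0 p.1 p.2))
      (Icc a b ×ˢ Icc (-π) π) := by
    refine continuous_fst.continuousOn.smul (hφ.comp hcircleMap.continuousOn ?_)
    rintro ⟨ρ, θ⟩ ⟨hρ, -⟩
    simpa [abs_of_nonneg (ha.trans hρ.1)] using hρ
  have hintegrable : IntegrableOn (fun p : ℝ × ℝ => p.1 • φ (circleMap 0 p.1 p.2))
      (Ioo a b ×ˢ Ioo (-π) π) :=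
    (hcont.integrableOn_compact (isCompact_Icc.prod isCompact_Icc)).mono_set
      (prod_mono Ioo_subset_Icc_self Ioo_subset_Icc_self)
  rw [setIntegral_annulus_eq_setIntegral_prod φ b ha, Measure.volume_eq_prod,
    setIntegral_prod _ (by rwa [← Measure.volume_eq_prod]),
    intervalIntegral.integral_of_le hab, integral_Ioc_eq_integral_Ioo]
  refine setIntegral_congr_fun measurableSet_Ioo fun ρ _ => ?_
  simp only
  rw [integral_smul, setIntegral_circleMap_eq_smul_circleAverage, smul_smul, mul_comm]

theorem setIntegral_annulus_inv_norm_sq {d M : ℝ} (hd : 0 < d) (hdM : d ≤ M) :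
    ∫ w in {z : ℂ | ‖z‖ ∈ Ioo d M}, (‖w‖ ^ 2)⁻¹ = 2 * π * Real.log (M / d) := by
  have hcont : ContinuousOn (fun w : ℂ => (‖w‖ ^ 2)⁻¹) {z | ‖z‖ ∈ Icc d M} :=
    ContinuousOn.inv₀ (by fun_prop) fun w hw => (pow_pos (hd.trans_le hw.1) 2).ne'
  rw [setIntegral_annulus_eq hd.le hdM hcont, ← integral_one_div_of_pos hd (hd.trans_le hdM),
    ← intervalIntegral.integral_const_mul]
  refine intervalIntegral.integral_congr fun ρ hρ => ?_
  rw [uIcc_of_le hdM] at hρ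
  have hρ0 : 0 < ρ := hd.trans_le hρ.1
  rw [Real.circleAverage_const_on_circle (a := (ρ ^ 2)⁻¹)]
  · simp only [smul_eq_mul]
    field_simp
  · intro x hx
    rw [show ‖x‖ = ρ by simpa [abs_of_pos hρ0] using hx]

theorem integrableOn_annulus_inv_norm_sq {d : ℝ} (M : ℝ) (hd : 0 < d) :
    IntegrableOn (fun w : ℂ => (‖w‖ ^ 2)⁻¹) {z | ‖z‖ ∈ Ioo d M} := by
  have hcont : ContinuousOn (fun w : ℂ => (‖w‖ ^ 2)⁻¹) {z | ‖z‖ ∈ Icc d M} :=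
    ContinuousOn.inv₀ (by fun_prop) fun w hw => (pow_pos (hd.trans_le hw.1) 2).ne'
  have hcompact : IsCompact {z : ℂ | ‖z‖ ∈ Icc d M} :=
    (isCompact_closedBall (0 : ℂ) M).of_isClosed_subset (isClosed_Icc.preimage continuous_norm)
      fun z hz => by simpa using hz.2
  exact (hcont.integrableOn_compact hcompact).mono_set fun z hz => Ioo_subset_Icc_self hz

theorem setIntegral_norm_deriv_sq_mul_comp {f : ℂ → ℂ} {s : Set ℂ} (hs : MeasurableSet s)
    (hf : ∀ z ∈ s, DifferentiableAt ℂ f z) (hinj : InjOn f s) (g : ℂ → ℝ) :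
    ∫ z in s, ‖deriv f z‖ ^ 2 * g (f z) = ∫ w in f '' s, g w := by
  have hdet (c : ℂ) :
      ((ContinuousLinearMap.toSpanSingleton ℂ c).restrictScalars ℝ).det = ‖c‖ ^ 2 := by
    have : (((ContinuousLinearMap.toSpanSingleton ℂ c).restrictScalars ℝ : ℂ →L[ℝ] ℂ) :
        ℂ →ₗ[ℝ] ℂ) = (c • (1 : ℂ →ₗ[ℂ] ℂ)).restrictScalars ℝ := by
      ext
      simp [mul_comm]
    rw [ContinuousLinearMap.det, this, LinearMap.det_restrictScalars]
    simp [Algebra.norm_complex_apply, Complex.normSq_eq_norm_sq]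
  rw [integral_image_eq_integral_abs_det_fderiv_smul volume hs
    (fun z hz =>
      ((hf z hz).hasDerivAt.hasFDerivAt.restrictScalars ℝ).hasFDerivWithinAt) hinj g]
  refine setIntegral_congr_fun hs fun z _ => ?_
  simp only [hdet, smul_eq_mul, abs_of_nonneg (sq_nonneg ‖deriv f z‖)]

theorem setIntegral_norm_logDeriv_sq_le {f : ℂ → ℂ} {s : Set ℂ} (hs : MeasurableSet s)
    {d M : ℝ} (hd : 0 < d) (hdM : d ≤ M)
    (hf : ∀ z ∈ s, DifferentiableAt ℂ f z) (hinj : InjOn f s)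
    (hfd : ∀ z ∈ s, d < ‖f z‖) (hfM : ∀ z ∈ s, ‖f z‖ < M) :
    ∫ z in s, ‖logDeriv f z‖ ^ 2 ≤ 2 * π * Real.log (M / d) := by
  calc ∫ z in s, ‖logDeriv f z‖ ^ 2
      = ∫ z in s, ‖deriv f z‖ ^ 2 * (‖f z‖ ^ 2)⁻¹ := by
        simp only [logDeriv_apply, norm_div, div_pow, ← div_eq_mul_inv]
    _ = ∫ w in f '' s, (‖w‖ ^ 2)⁻¹ :=
        setIntegral_norm_deriv_sq_mul_comp hs hf hinj fun w => (‖w‖ ^ 2)⁻¹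
    _ ≤ ∫ w in {z : ℂ | ‖z‖ ∈ Ioo d M}, (‖w‖ ^ 2)⁻¹ := by
        refine setIntegral_mono_set (integrableOn_annulus_inv_norm_sq M hd)
          (Eventually.of_forall fun w => by simp only [Pi.zero_apply]; positivity)
          (LE.le.eventuallyLE ?_)
        rintro _ ⟨z, hz, rfl⟩
        exact ⟨hfd z hz, hfM z hz⟩
    _ = 2 * π * Real.log (M / d) := setIntegral_annulus_inv_norm_sq hd hdM

/-- The function representing `q' ↦ π * (q z - q 0)` in the Bergman space of the disc of radius `r`
about the origin. -/
noncomputable def primitiveKernel (r : ℝ) (z w : ℂ) : ℂ :=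
  z / (r ^ 2 - z * conj w)

theorem sq_sub_mul_conj_ne_zero {r : ℝ} {z w : ℂ} (hz : ‖z‖ < r) (hw : ‖w‖ ≤ r) :
    (r : ℂ) ^ 2 - z * conj w ≠ 0 := by
  intro h
  have hr : 0 < r := (norm_nonneg z).trans_lt hz
  have hnorm : ‖(r : ℂ) ^ 2‖ = ‖z * conj w‖ := by rw [sub_eq_zero.mp h]
  rw [norm_mul, RCLike.norm_conj, norm_pow, Complex.norm_real, Real.norm_of_nonneg hr.le] at hnorm
  nlinarith [norm_nonneg z, norm_nonneg w]

theorem continuousOn_primitiveKernel {r : ℝ} {z : ℂ} (hz : ‖z‖ < r) :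
    ContinuousOn (primitiveKernel r z) (closedBall 0 r) :=
  continuousOn_const.div (by fun_prop) fun _ hw =>
    sq_sub_mul_conj_ne_zero hz (mem_closedBall_zero_iff.mp hw)

theorem norm_mul_sq_div_sq_le {r ρ : ℝ} {z : ℂ} (hz : ‖z‖ < r) (hρ : 0 ≤ ρ) (hρr : ρ ≤ r) :
    ‖z * (ρ : ℂ) ^ 2 / (r : ℂ) ^ 2‖ ≤ ‖z‖ / r * ρ := by
  have hr : 0 < r := (norm_nonneg z).trans_lt hz
  rw [norm_div, norm_mul, norm_pow, norm_pow, Complex.norm_real, Complex.norm_real,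
    Real.norm_of_nonneg hr.le, Real.norm_of_nonneg hρ,
    show ‖z‖ * ρ ^ 2 / r ^ 2 = ‖z‖ / r * ρ * (ρ / r) by field_simp]
  exact mul_le_of_le_one_right (by positivity) ((div_le_one hr).mpr hρr)

/-- On the circle of radius `ρ` one has `conj w = ρ ^ 2 / w`, which turns the kernel into a Cauchy
kernel with pole at `z * ρ ^ 2 / r ^ 2`. -/
theorem circleAverage_mul_primitiveKernel {g : ℂ → ℂ} {r ρ : ℝ} (hρ : 0 < ρ) (hρr : ρ ≤ r)
    (hg : DiffContOnCl ℂ g (ball 0 ρ)) {z : ℂ} (hz : ‖z‖ < r) :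
    Real.circleAverage (fun w => g w * primitiveKernel r z w) 0 ρ =
      z / r ^ 2 * g (z * ρ ^ 2 / r ^ 2) := by
  have hr : 0 < r := (norm_nonneg z).trans_lt hz
  have hr0 : (r : ℂ) ≠ 0 := by exact_mod_cast hr.ne'
  have hmem : z * ρ ^ 2 / r ^ 2 ∈ ball (0 : ℂ) |ρ| := by
    rw [mem_ball_zero_iff, abs_of_pos hρ]
    refine (norm_mul_sq_div_sq_le hz hρ.le hρr).trans_lt ?_
    exact mul_lt_of_lt_one_left hρ ((div_lt_one hr).mpr hz)
  rw [← DiffContOnCl.circleAverage_smul_div (f := g) (by rwa [abs_of_pos hρ]) hmem, ← smul_eq_mul,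
    ← Real.circleAverage_fun_smul]
  refine Real.circleAverage_congr_sphere fun w hw => ?_
  have hwρ : ‖w‖ = ρ := by simpa [abs_of_pos hρ] using hw
  have hw0 : w ≠ 0 := by rw [← norm_pos_iff, hwρ]; exact hρ
  have hconj : conj w = ρ ^ 2 / w := by
    rw [eq_div_iff hw0, mul_comm, Complex.mul_conj, Complex.normSq_eq_norm_sq, hwρ]
    push_cast; ring
  have hne : (r : ℂ) ^ 2 - z * (ρ ^ 2 / w) ≠ 0 :=
    hconj ▸ sq_sub_mul_conj_ne_zero hz (hwρ.le.trans hρr)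
  have : w - z * ρ ^ 2 / r ^ 2 ≠ 0 := by
    intro h
    refine hne ?_
    field_simp at h ⊢
    simpa using h
  simp only [primitiveKernel, smul_eq_mul, sub_zero]
  rw [hconj]
  field_simp

theorem integral_deriv_comp_mul_sq {q : ℂ → ℂ} {r R : ℝ} (hrR : r < R)
    (hq : DifferentiableOn ℂ q (ball 0 R)) {z : ℂ} (hz : ‖z‖ < r) :
    ∫ ρ in (0 : ℝ)..r, (2 * π * ρ) • (z / r ^ 2 * deriv q (z * ρ ^ 2 / r ^ 2)) =
      π * (q z - q 0) := by
  have hr : 0 < r := (norm_nonneg z).trans_lt hz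
  have hr0 : (r : ℂ) ≠ 0 := by exact_mod_cast hr.ne'
  have hmem : ∀ ρ ∈ uIcc 0 r, z * (ρ : ℂ) ^ 2 / (r : ℂ) ^ 2 ∈ ball (0 : ℂ) R := by
    intro ρ hρ
    rw [uIcc_of_le hr.le] at hρ
    refine mem_ball_zero_iff.mpr ((norm_mul_sq_div_sq_le hz hρ.1 hρ.2).trans_lt ?_)
    exact (mul_le_of_le_one_left hρ.1 ((div_le_one hr).mpr hz.le)).trans_lt (hρ.2.trans_lt hrR)
  have hderiv : ∀ ρ ∈ uIcc 0 r, HasDerivAt (fun ρ : ℝ => (π : ℂ) * q (z * ρ ^ 2 / r ^ 2))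
      ((2 * π * ρ) • (z / r ^ 2 * deriv q (z * ρ ^ 2 / r ^ 2))) ρ := by
    intro ρ hρ
    have hinner : HasDerivAt (fun ρ : ℝ => z * (ρ : ℂ) ^ 2 / r ^ 2) (z * (2 * ρ) / r ^ 2) ρ := by
      simpa using
        (((Complex.ofRealCLM.hasDerivAt (x := ρ)).pow 2).const_mul z).div_const ((r : ℂ) ^ 2)
    have houter := (hq.differentiableAt (isOpen_ball.mem_nhds (hmem ρ hρ))).hasDerivAt
    refine ((houter.scomp ρ hinner).const_mul (π : ℂ)).congr_deriv ?_
    rw [Complex.real_smul, smul_eq_mul]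
    push_cast
    ring
  have hcont : ContinuousOn (fun ρ : ℝ =>
      (2 * π * ρ) • (z / r ^ 2 * deriv q (z * ρ ^ 2 / r ^ 2))) (uIcc 0 r) := by
    refine (show Continuous fun ρ : ℝ => 2 * π * ρ by fun_prop).continuousOn.smul
      (continuousOn_const.mul ?_)
    exact (hq.deriv isOpen_ball).continuousOn.comp
      (f := fun ρ : ℝ => z * (ρ : ℂ) ^ 2 / (r : ℂ) ^ 2) (by fun_prop) hmem
  rw [intervalIntegral.integral_eq_sub_of_hasDerivAt hderiv hcont.intervalIntegrable,
    mul_div_assoc, div_self (pow_ne_zero 2 hr0)]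
  simp
  ring

theorem setIntegral_deriv_mul_primitiveKernel {q : ℂ → ℂ} {r R : ℝ} (hrR : r < R)
    (hq : DifferentiableOn ℂ q (ball 0 R)) {z : ℂ} (hz : ‖z‖ < r) :
    ∫ w in {w : ℂ | ‖w‖ ∈ Ioo 0 r}, deriv q w * primitiveKernel r z w = π * (q z - q 0) := by
  have hr : 0 < r := (norm_nonneg z).trans_lt hz
  have hderiv : DifferentiableOn ℂ (deriv q) (ball 0 R) := hq.deriv isOpen_ball
  have hcont : ContinuousOn (fun w => deriv q w * primitiveKernel r z w)
      {w : ℂ | ‖w‖ ∈ Icc 0 r} :=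
    ((hderiv.continuousOn.mono (closedBall_subset_ball hrR)).mul
      (continuousOn_primitiveKernel hz)).mono fun w hw => mem_closedBall_zero_iff.mpr hw.2
  rw [setIntegral_annulus_eq le_rfl hr.le hcont, ← integral_deriv_comp_mul_sq hrR hq hz]
  simp only [intervalIntegral.integral_of_le hr.le, integral_Ioc_eq_integral_Ioo]
  refine setIntegral_congr_fun measurableSet_Ioo fun ρ hρ => ?_
  rw [circleAverage_mul_primitiveKernel hρ.1 hρ.2.le
    ((hderiv.mono (closedBall_subset_ball (hρ.2.trans hrR))).diffContOnCl_ball subset_rfl) hz]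

theorem exists_radius_norm_mul_lt_sq {r : ℝ} {z : ℂ} (hz : ‖z‖ < r) :
    ∃ R, r < R ∧ ‖z‖ * R < r ^ 2 := by
  have hlim : Tendsto (fun R => ‖z‖ * R) (𝓝[>] r) (𝓝 (‖z‖ * r)) :=
    (Continuous.tendsto (by fun_prop) r).mono_left nhdsWithin_le_nhds
  have hlt : ‖z‖ * r < r ^ 2 := by nlinarith [norm_nonneg z]
  exact (eventually_mem_nhdsWithin.and (hlim.eventually_lt_const hlt)).exists

theorem hasDerivAt_neg_log_one_sub_conj_mul_div {r : ℝ} (hr : 0 < r) {z w : ℂ}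
    (hzw : ‖z‖ * ‖w‖ < r ^ 2) :
    HasDerivAt (fun w => -Complex.log (1 - conj z * w / r ^ 2)) (conj (primitiveKernel r z w))
      w := by
  have hr0 : (r : ℂ) ≠ 0 := by exact_mod_cast hr.ne'
  have hlt : ‖conj z * w / (r : ℂ) ^ 2‖ < 1 := by
    rwa [norm_div, norm_mul, RCLike.norm_conj, norm_pow, Complex.norm_real,
      Real.norm_of_nonneg hr.le, div_lt_one (by positivity)]
  have hslit : 1 - conj z * w / (r : ℂ) ^ 2 ∈ Complex.slitPlane := by
    refine Or.inl ?_
    have := (Complex.re_le_norm _).trans_lt hlt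
    simp only [Complex.sub_re, Complex.one_re]
    linarith
  have hinner : HasDerivAt (fun w => 1 - conj z * w / (r : ℂ) ^ 2) (-(conj z / r ^ 2)) w := by
    simpa using
      (((hasDerivAt_id w).const_mul (conj z)).div_const ((r : ℂ) ^ 2)).const_sub 1
  refine (hinner.clog hslit).neg.congr_deriv ?_
  have := Complex.slitPlane_ne_zero hslit
  have hfactor : (r : ℂ) ^ 2 - conj z * w = r ^ 2 * (1 - conj z * w / r ^ 2) := by
    field_simp
  simp only [primitiveKernel, map_div₀, map_sub, map_pow, map_mul, Complex.conj_ofReal,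
    Complex.conj_conj]
  rw [hfactor]
  field_simp

/-- This is the reproducing formula applied to the primitive of the kernel itself, which is
`w ↦ -log (1 - conj z * w / r ^ 2)` up to conjugation. -/
theorem setIntegral_norm_primitiveKernel_sq {r : ℝ} {z : ℂ} (hz : ‖z‖ < r) :
    ∫ w in {w : ℂ | ‖w‖ ∈ Ioo 0 r}, ‖primitiveKernel r z w‖ ^ 2 =
      -(π * Real.log (1 - ‖z‖ ^ 2 / r ^ 2)) := by
  have hr : 0 < r := (norm_nonneg z).trans_lt hz
  obtain ⟨R, hrR, hR⟩ := exists_radius_norm_mul_lt_sq hz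
  have hderiv : ∀ w ∈ ball (0 : ℂ) R,
      HasDerivAt (fun w => -Complex.log (1 - conj z * w / r ^ 2)) (conj (primitiveKernel r z w))
        w :=
    fun w hw => hasDerivAt_neg_log_one_sub_conj_mul_div hr <|
      (mul_le_mul_of_nonneg_left (mem_ball_zero_iff.mp hw).le (norm_nonneg z)).trans_lt hR
  have hreproduce := setIntegral_deriv_mul_primitiveKernel hrR
    (fun w hw => (hderiv w hw).differentiableAt.differentiableWithinAt) hz
  have hnormSq : ∫ w in {w : ℂ | ‖w‖ ∈ Ioo 0 r},
      deriv (fun w => -Complex.log (1 - conj z * w / r ^ 2)) w * primitiveKernel r z w =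
      ((∫ w in {w : ℂ | ‖w‖ ∈ Ioo 0 r}, ‖primitiveKernel r z w‖ ^ 2 : ℝ) : ℂ) := by
    rw [← integral_complex_ofReal]
    refine setIntegral_congr_fun (measurableSet_Ioo.preimage measurable_norm) fun w hw => ?_
    rw [(hderiv w (mem_ball_zero_iff.mpr (hw.2.trans hrR))).deriv, mul_comm, Complex.mul_conj,
      Complex.normSq_eq_norm_sq]
  have hdiag : conj z * z / (r : ℂ) ^ 2 = ((‖z‖ ^ 2 / r ^ 2 : ℝ) : ℂ) := by
    rw [mul_comm, Complex.mul_conj, Complex.normSq_eq_norm_sq]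
    push_cast; rfl
  have hnonneg : (0 : ℝ) ≤ 1 - ‖z‖ ^ 2 / r ^ 2 := by
    rw [sub_nonneg, div_le_one (by positivity)]
    exact pow_le_pow_left₀ (norm_nonneg z) hz.le 2
  rw [hnormSq, hdiag, ← Complex.ofReal_one, ← Complex.ofReal_sub,
    ← Complex.ofReal_log hnonneg] at hreproduce
  simpa using congrArg Complex.re hreproduce

theorem exists_hasDerivAt_logDeriv_of_ball {f : ℂ → ℂ} {c : ℂ} {R : ℝ}
    (hf : DifferentiableOn ℂ f (ball c R)) (hne : ∀ z ∈ ball c R, f z ≠ 0) :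
    ∃ q : ℂ → ℂ, (∀ z ∈ ball c R, HasDerivAt q (logDeriv f z) z) ∧
      ∀ z ∈ ball c R, f z = f c * Complex.exp (q z - q c) := by
  obtain ⟨q, hq⟩ := ((hf.deriv isOpen_ball).div hf hne).isExactOn_ball
  refine ⟨q, hq, fun z hz => ?_⟩
  have hderiv : ∀ w ∈ ball c R, HasDerivAt (fun w => f w * Complex.exp (-q w)) 0 w := by
    intro w hw
    refine ((hf.differentiableAt (isOpen_ball.mem_nhds hw)).hasDerivAt.mul
      (hq w hw).neg.cexp).congr_deriv ?_
    have := hne w hw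
    simp only [Pi.div_apply]
    field_simp
    ring
  have hconst := isOpen_ball.is_const_of_deriv_eq_zero isPreconnected_ball
    (fun w hw => (hderiv w hw).differentiableAt.differentiableWithinAt)
    (fun w hw => (hderiv w hw).deriv) hz (mem_ball_self (nonempty_ball.mp ⟨z, hz⟩))
  simp only [Complex.exp_neg] at hconst
  rw [Complex.exp_sub]
  have := Complex.exp_ne_zero (q z)
  have := Complex.exp_ne_zero (q c)
  field_simp at hconst ⊢
  linear_combination hconst

theorem re_sub_le_of_setIntegral_norm_deriv_sq_le {q : ℂ → ℂ} {r R A : ℝ} (hrR : r < R)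
    (hq : DifferentiableOn ℂ q (ball 0 R))
    (hA : ∫ w in {w : ℂ | ‖w‖ ∈ Ioo 0 r}, ‖deriv q w‖ ^ 2 ≤ π * A) {z : ℂ} (hz : ‖z‖ < r) :
    (q z - q 0).re ≤ A / 4 - Real.log (1 - ‖z‖ ^ 2 / r ^ 2) := by
  have hintegrable {g : ℂ → ℂ} (hg : ContinuousOn g (closedBall 0 r)) :
      IntegrableOn (fun w => ‖g w‖ ^ 2) {w : ℂ | ‖w‖ ∈ Ioo 0 r} :=
    ((hg.norm.pow 2).integrableOn_compact (isCompact_closedBall 0 r)).mono_set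
      fun w hw => mem_closedBall_zero_iff.mpr hw.2.le
  have hintq := hintegrable ((hq.deriv isOpen_ball).continuousOn.mono (closedBall_subset_ball hrR))
  have hintK := hintegrable (continuousOn_primitiveKernel hz)
  have hle := calc π * (q z - q 0).re
      = (π * (q z - q 0)).re := by simp
    _ ≤ ‖(π * (q z - q 0) : ℂ)‖ := Complex.re_le_norm _
    _ ≤ ∫ w in {w : ℂ | ‖w‖ ∈ Ioo 0 r},
        (‖deriv q w‖ ^ 2 / 4 + ‖primitiveKernel r z w‖ ^ 2) := by
      rw [← setIntegral_deriv_mul_primitiveKernel hrR hq hz]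
      refine norm_integral_le_of_norm_le ((hintq.div_const 4).add hintK) ?_
      refine Eventually.of_forall fun w => ?_
      rw [norm_mul]
      nlinarith [sq_nonneg (‖deriv q w‖ / 2 - ‖primitiveKernel r z w‖)]
  rw [integral_add (hintq.div_const 4) hintK, integral_div,
    setIntegral_norm_primitiveKernel_sq hz] at hle
  refine le_of_mul_le_mul_left ?_ Real.pi_pos
  linarith

theorem log_norm_div_le_of_injOn {f : ℂ → ℂ} {r R d M : ℝ} (hrR : r < R)
    (hf : DifferentiableOn ℂ f (ball 0 R)) (hinj : InjOn f (ball 0 R))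
    (hd : 0 < d) (hfd : ∀ z ∈ ball (0 : ℂ) R, d < ‖f z‖)
    (hfM : ∀ z ∈ ball (0 : ℂ) r, ‖f z‖ < M) {z : ℂ} (hz : ‖z‖ < r) :
    Real.log (‖f z‖ / ‖f 0‖) ≤ Real.log (M / d) / 2 - Real.log (1 - ‖z‖ ^ 2 / r ^ 2) := by
  have hne : ∀ w ∈ ball (0 : ℂ) R, f w ≠ 0 := fun w hw =>
    norm_pos_iff.mp (hd.trans (hfd w hw))
  obtain ⟨q, hq, hfq⟩ := exists_hasDerivAt_logDeriv_of_ball hf hne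
  have hzR : z ∈ ball (0 : ℂ) R := mem_ball_zero_iff.mpr (hz.trans hrR)
  have hlog : Real.log (‖f z‖ / ‖f 0‖) = (q z - q 0).re := by
    rw [hfq z hzR, norm_mul, mul_div_cancel_left₀, Complex.norm_exp, Real.log_exp]
    exact norm_ne_zero_iff.mpr (hne 0 (mem_ball_self (nonempty_ball.mp ⟨z, hzR⟩)))
  have hsub : {w : ℂ | ‖w‖ ∈ Ioo 0 r} ⊆ ball 0 r := fun w hw => mem_ball_zero_iff.mpr hw.2
  have hsubR := hsub.trans (ball_subset_ball hrR.le)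
  have hmeas : MeasurableSet {w : ℂ | ‖w‖ ∈ Ioo 0 r} := measurableSet_Ioo.preimage measurable_norm
  have harea : ∫ w in {w : ℂ | ‖w‖ ∈ Ioo 0 r}, ‖deriv q w‖ ^ 2 ≤ π * (2 * Real.log (M / d)) := by
    rw [setIntegral_congr_fun hmeas fun w hw => by rw [(hq w (hsubR hw)).deriv]]
    refine (setIntegral_norm_logDeriv_sq_le hmeas hd
      ((hfd z hzR).le.trans (hfM z (mem_ball_zero_iff.mpr hz)).le)
      (fun w hw => hf.differentiableAt (isOpen_ball.mem_nhds (hsubR hw))) (hinj.mono hsubR)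
      (fun w hw => hfd w (hsubR hw)) (fun w hw => hfM w (hsub hw))).trans_eq ?_
    ring
  have hbound := re_sub_le_of_setIntegral_norm_deriv_sq_le hrR
    (fun w hw => (hq w hw).differentiableAt.differentiableWithinAt) harea hz
  rw [hlog]
  linarith

/-- At a maximum point `z₀` of the weighted modulus, the maximum itself bounds `f` on the disc of
radius `(‖z₀‖ + R) / 2`; feeding this into `log_norm_div_le_of_injOn` bounds the maximum. -/
theorem sq_sub_norm_mul_norm_le_of_isMaxOn {f : ℂ → ℂ} {R d : ℝ} (hR1 : R < 1)
    (hf : DifferentiableOn ℂ f (ball 0 1)) (hinj : InjOn f (ball 0 1)) (hd : 0 < d)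
    (hfd : ∀ z ∈ ball (0 : ℂ) 1, d < ‖f z‖) {z₀ : ℂ} (hz₀ : ‖z₀‖ < R)
    (hmax : IsMaxOn (fun z => (R - ‖z‖) ^ 2 * ‖f z‖) (closedBall 0 R) z₀) :
    (R - ‖z₀‖) ^ 2 * ‖f z₀‖ ≤ 32 * ‖f 0‖ ^ 2 / d := by
  have hf0 : 0 < ‖f 0‖ := hd.trans (hfd 0 (mem_ball_self one_pos))
  have hfz₀ : 0 < ‖f z₀‖ := hd.trans (hfd z₀ (mem_ball_zero_iff.mpr (hz₀.trans hR1)))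
  set s := ‖z₀‖
  have hs : 0 ≤ s := norm_nonneg z₀
  have hRs : 0 < R - s := sub_pos.mpr hz₀
  obtain ⟨r, hr⟩ : ∃ r, r = (s + R) / 2 := ⟨_, rfl⟩
  have hr0 : 0 < r := by linarith
  have hM : ∀ w ∈ ball (0 : ℂ) r, ‖f w‖ < 8 * ‖f z₀‖ := by
    intro w hw
    have hwr : ‖w‖ < r := mem_ball_zero_iff.mp hw
    have hle : (R - ‖w‖) ^ 2 * ‖f w‖ ≤ (R - s) ^ 2 * ‖f z₀‖ :=
      hmax (mem_closedBall_zero_iff.mpr (by linarith))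
    have hsq : ((R - s) / 2) ^ 2 ≤ (R - ‖w‖) ^ 2 := pow_le_pow_left₀ (by linarith) (by linarith) 2
    have := mul_le_mul_of_nonneg_right hsq (norm_nonneg (f w))
    refine lt_of_mul_lt_mul_left ?_ (sq_nonneg (R - s))
    nlinarith [mul_pos (pow_pos hRs 2) hfz₀]
  have hlog := log_norm_div_le_of_injOn (show r < 1 by linarith) hf hinj hd hfd hM
    (show s < r by linarith)
  have hgap : (R - s) / 2 ≤ 1 - s ^ 2 / r ^ 2 := by
    rw [le_sub_iff_add_le, ← le_sub_iff_add_le', div_le_iff₀ (by positivity)]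
    have hrs : 0 < r - s := by linarith
    rw [show (R - s) / 2 = r - s by linarith]
    nlinarith [mul_pos hrs hr0, mul_nonneg (mul_pos hrs hr0).le (show 0 ≤ 1 - r by linarith)]
  have hlog_gap := Real.log_le_log (by linarith) hgap
  have hlog_sq : Real.log ((‖f z₀‖ / ‖f 0‖) ^ 2 * ((R - s) / 2) ^ 2) ≤
      Real.log (8 * ‖f z₀‖ / d) := by
    rw [Real.log_mul (by positivity) (by positivity), Real.log_pow, Real.log_pow]
    push_cast
    linarith
  have hle := (Real.log_le_log_iff (by positivity) (by positivity)).mp hlog_sq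
  rw [le_div_iff₀ hd]
  field_simp at hle
  nlinarith

theorem sq_sub_norm_mul_norm_le_of_injOn {f : ℂ → ℂ} {R d : ℝ} (hR1 : R < 1)
    (hf : DifferentiableOn ℂ f (ball 0 1)) (hinj : InjOn f (ball 0 1)) (hd : 0 < d)
    (hfd : ∀ z ∈ ball (0 : ℂ) 1, d < ‖f z‖) {z : ℂ} (hz : ‖z‖ ≤ R) :
    (R - ‖z‖) ^ 2 * ‖f z‖ ≤ 32 * ‖f 0‖ ^ 2 / d := by
  have hcont : ContinuousOn (fun z => (R - ‖z‖) ^ 2 * ‖f z‖) (closedBall 0 R) :=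
    (by fun_prop : Continuous fun z : ℂ => (R - ‖z‖) ^ 2).continuousOn.mul
      (hf.continuousOn.mono (closedBall_subset_ball hR1)).norm
  have hzR : z ∈ closedBall (0 : ℂ) R := mem_closedBall_zero_iff.mpr hz
  obtain ⟨z₀, hz₀, hmax⟩ := (isCompact_closedBall (0 : ℂ) R).exists_isMaxOn ⟨z, hzR⟩ hcont
  refine (hmax hzR).trans ?_
  rcases (mem_closedBall_zero_iff.mp hz₀).eq_or_lt with hboundary | hinterior
  · simp only [hboundary, sub_self, ne_eq, OfNat.ofNat_ne_zero, not_false_eq_true, zero_pow,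
      zero_mul]
    positivity
  · exact sq_sub_norm_mul_norm_le_of_isMaxOn hR1 hf hinj hd hfd hinterior hmax

theorem norm_le_of_injOn_ball {f : ℂ → ℂ} (hf : DifferentiableOn ℂ f (ball 0 1))
    (hinj : InjOn f (ball 0 1)) {d : ℝ} (hd : 0 < d)
    (hfd : ∀ z ∈ ball (0 : ℂ) 1, d < ‖f z‖) {z : ℂ} (hz : ‖z‖ < 1) :
    ‖f z‖ ≤ 32 * ‖f 0‖ ^ 2 / d / (1 - ‖z‖) ^ 2 := by
  have hlim : Tendsto (fun R : ℝ => (R - ‖z‖) ^ 2 * ‖f z‖) (𝓝[<] 1)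
      (𝓝 ((1 - ‖z‖) ^ 2 * ‖f z‖)) :=
    (Continuous.tendsto (by fun_prop) 1).mono_left nhdsWithin_le_nhds
  have hle := le_of_tendsto hlim <| by
    filter_upwards [Ioo_mem_nhdsLT hz] with R hR
    exact sq_sub_norm_mul_norm_le_of_injOn hR.2 hf hinj hd hfd hR.1.le
  rw [le_div_iff₀ (pow_pos (sub_pos.mpr hz) 2), mul_comm]
  exact hle

/-! ### Branches of the inverse over a half plane -/

/-- `F` is a meromorphic function in normal form which has no singular values in the punctured
neighbourhood `exp L < |w| < ∞` of infinity. -/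
structure UnramifiedAbove (F : ℂ → ℂ) (L : ℝ) : Prop where
  normalForm : ∀ z, MeromorphicNFAt F z
  deriv_ne_zero : ∀ z, Real.exp L < ‖F z‖ → deriv F z ≠ 0
  not_asymptotic : ∀ (w : ℂ) (γ : ℝ → ℂ), Real.exp L < ‖w‖ → ContinuousOn γ (Ici 0) →
    Tendsto γ atTop (cocompact ℂ) → ¬ Tendsto (fun t => F (γ t)) atTop (𝓝 w)

/-- The half plane `Re ζ > L`. -/
def rightHalfPlane (L : ℝ) : Set ℂ := {ζ | L < ζ.re}

theorem isOpen_rightHalfPlane (L : ℝ) : IsOpen (rightHalfPlane L) :=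
  isOpen_lt continuous_const Complex.continuous_re

theorem convex_rightHalfPlane (L : ℝ) : Convex ℝ (rightHalfPlane L) :=
  convex_halfSpace_re_gt L

theorem rightHalfPlane_subset {L L' : ℝ} (h : L ≤ L') : rightHalfPlane L' ⊆ rightHalfPlane L :=
  fun _ hζ => lt_of_le_of_lt h hζ

theorem exp_lt_norm_exp {L : ℝ} {ζ : ℂ} (h : ζ ∈ rightHalfPlane L) :
    Real.exp L < ‖Complex.exp ζ‖ := by
  rw [Complex.norm_exp]
  exact Real.exp_lt_exp.mpr h

/-- `ψ` is a branch on `Re ζ > L` of the inverse of the logarithm of `F`. -/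
structure IsLogInverse (F : ℂ → ℂ) (L : ℝ) (ψ : ℂ → ℂ) : Prop where
  continuousOn : ContinuousOn ψ (rightHalfPlane L)
  map_eq : ∀ ζ ∈ rightHalfPlane L, F (ψ ζ) = Complex.exp ζ

theorem eq_zero_and_tendsto_of_not_analyticAt {F : ℂ → ℂ} {z : ℂ} (hF : MeromorphicNFAt F z)
    (h : ¬ AnalyticAt ℂ F z) : F z = 0 ∧ Tendsto F (𝓝[≠] z) (Bornology.cobounded ℂ) := by
  rcases meromorphicNFAt_iff_analyticAt_or.mp hF with han | ⟨hmero, hpole, hzero⟩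
  · exact absurd han h
  · exact ⟨hzero, (tendsto_cobounded_iff_meromorphicOrderAt_neg hmero).mpr hpole⟩

theorem eventually_eq_zero_or_lt_norm {F : ℂ → ℂ} {z : ℂ} (hF : MeromorphicNFAt F z)
    (h : ¬ AnalyticAt ℂ F z) (K : ℝ) : ∀ᶠ y in 𝓝 z, F y = 0 ∨ K < ‖F y‖ := by
  obtain ⟨hzero, hpole⟩ := eq_zero_and_tendsto_of_not_analyticAt hF h
  have hlarge := hpole.eventually ((tendsto_norm_cobounded_atTop (E := ℂ)).eventually_gt_atTop K)
  filter_upwards [eventually_nhdsWithin_iff.mp hlarge] with y hy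
  by_cases hyz : y = z
  · exact Or.inl (hyz ▸ hzero)
  · exact Or.inr (hy hyz)

theorem exists_mapClusterPt_of_not_tendsto_cocompact {X Y : Type*} [TopologicalSpace Y]
    {l : Filter X} {G : X → Y} (h : ¬ Tendsto G l (cocompact Y)) : ∃ z, MapClusterPt z l G := by
  rw [(hasBasis_cocompact (X := Y)).tendsto_right_iff] at h
  push Not at h
  obtain ⟨K, hK, hfreq⟩ := h
  simp only [mem_compl_iff, not_not] at hfreq
  have : (map G l ⊓ 𝓟 K).NeBot := frequently_mem_iff_neBot.mp hfreq
  obtain ⟨z, -, hz⟩ := hK.exists_clusterPt (f := map G l ⊓ 𝓟 K) inf_le_right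
  exact ⟨z, hz.mono inf_le_left⟩

-- Near a pole `F` is large except at the pole itself, where the normal form has the value `0`.
theorem analyticAt_of_mapClusterPt {F : ℂ → ℂ} {z w : ℂ} (hF : MeromorphicNFAt F z) (hw : w ≠ 0)
    {α : Type*} {l : Filter α} {G : α → ℂ} (hz : MapClusterPt z l G)
    (hlim : Tendsto (fun x => F (G x)) l (𝓝 w)) : AnalyticAt ℂ F z := by
  by_contra h
  have hlarge := eventually_eq_zero_or_lt_norm hF h (‖w‖ + 1)
  have hsmall : ∀ᶠ x in l, F (G x) ≠ 0 ∧ ‖F (G x)‖ < ‖w‖ + 1 :=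
    (hlim.eventually_ne hw).and (hlim.norm.eventually_lt_const (by linarith))
  obtain ⟨x, hx, hne, hlt⟩ :=
    ((mapClusterPt_iff_frequently.mp hz _ hlarge).and_eventually hsmall).exists
  exact hx.elim hne hlt.asymm

theorem eq_of_mapClusterPt {F : ℂ → ℂ} {z w : ℂ} (hF : MeromorphicNFAt F z) (hw : w ≠ 0)
    {α : Type*} {l : Filter α} {G : α → ℂ} (hz : MapClusterPt z l G)
    (hlim : Tendsto (fun x => F (G x)) l (𝓝 w)) : F z = w :=
  have han := analyticAt_of_mapClusterPt hF hw hz hlim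
  have hcl : MapClusterPt (F z) l (fun x => F (G x)) := hz.continuousAt_comp han.continuousAt
  eq_of_nhds_neBot (ClusterPt.mono hcl hlim)

/-- `Γ` lifts the path `c` through `F` along `s`, with initial value `z₀`. Paths are indexed by the
whole line and are constant for negative times, so that no time is a boundary point. -/
structure IsPathLift (F : ℂ → ℂ) (c : ℝ → ℂ) (z₀ : ℂ) (s : Set ℝ) (Γ : ℝ → ℂ) : Prop where
  continuousOn : ContinuousOn Γ s
  eq_base : ∀ x ∈ s, x ≤ 0 → Γ x = z₀
  map_eq : ∀ x ∈ s, F (Γ x) = c x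

theorem IsPathLift.mono {F : ℂ → ℂ} {c : ℝ → ℂ} {z₀ : ℂ} {s t : Set ℝ} {Γ : ℝ → ℂ}
    (h : IsPathLift F c z₀ t Γ) (hst : s ⊆ t) : IsPathLift F c z₀ s Γ :=
  ⟨h.continuousOn.mono hst, fun x hx => h.eq_base x (hst hx), fun x hx => h.map_eq x (hst hx)⟩

namespace UnramifiedAbove

variable {F : ℂ → ℂ} {L : ℝ} (hF : UnramifiedAbove F L)
include hF

theorem analyticAt {z : ℂ} (hz : Real.exp L < ‖F z‖) : AnalyticAt ℂ F z := by
  by_contra h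
  rw [(eq_zero_and_tendsto_of_not_analyticAt (hF.normalForm z) h).1, norm_zero] at hz
  exact lt_asymm hz (Real.exp_pos L)

theorem isOpen : IsOpen {z | Real.exp L < ‖F z‖} :=
  isOpen_iff_mem_nhds.mpr fun _ hz => (hF.analyticAt hz).continuousAt.norm.eventually_const_lt hz

theorem exists_openPartialHomeomorph {z : ℂ} (hz : Real.exp L < ‖F z‖) :
    ∃ e : OpenPartialHomeomorph ℂ ℂ, z ∈ e.source ∧ ⇑e = F := by
  have h := ((hF.analyticAt hz).hasStrictDerivAt).hasStrictFDerivAt_equiv (hF.deriv_ne_zero z hz)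
  exact ⟨h.toOpenPartialHomeomorph F, h.mem_toOpenPartialHomeomorph_source,
    h.toOpenPartialHomeomorph_coe⟩

theorem isLocalHomeomorph :
    IsLocalHomeomorph fun z : {z | Real.exp L < ‖F z‖} => F z := by
  have hloc : IsLocalHomeomorphOn F {z | Real.exp L < ‖F z‖} :=
    IsLocalHomeomorphOn.mk _ _ fun z hz => by
      obtain ⟨e, he, he'⟩ := hF.exists_openPartialHomeomorph hz
      exact ⟨e, he, fun x _ => by rw [he']⟩
  rw [isLocalHomeomorph_iff_isLocalHomeomorphOn_univ]
  exact hloc.comp (isLocalHomeomorph_iff_isLocalHomeomorphOn_univ.mp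
    hF.isOpen.isOpenEmbedding_subtypeVal.isLocalHomeomorph) fun z _ => z.2

theorem eqOn_of_lift {X : Type*} [TopologicalSpace X] {S : Set X} (hS : IsPreconnected S)
    {g₁ g₂ : X → ℂ} (h₁ : ContinuousOn g₁ S) (h₂ : ContinuousOn g₂ S)
    (hlift : ∀ x ∈ S, F (g₁ x) = F (g₂ x)) (hL : ∀ x ∈ S, Real.exp L < ‖F (g₁ x)‖)
    {x₀ : X} (hx₀ : x₀ ∈ S) (heq : g₁ x₀ = g₂ x₀) : EqOn g₁ g₂ S := by
  have := isPreconnected_iff_preconnectedSpace.mp hS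
  let G₁ : S → {z | Real.exp L < ‖F z‖} := fun x => ⟨g₁ x, hL x x.2⟩
  let G₂ : S → {z | Real.exp L < ‖F z‖} := fun x => ⟨g₂ x, by
    rw [mem_ofPred_eq, ← hlift x x.2]; exact hL x x.2⟩
  have hG := (T2Space.isSeparatedMap fun z : {z | Real.exp L < ‖F z‖} => F z).eq_of_comp_eq
    hF.isLocalHomeomorph.isLocallyInjective (g₁ := G₁) (g₂ := G₂)
    ((continuousOn_iff_continuous_domRestrict.mp h₁).subtype_mk _)
    ((continuousOn_iff_continuous_domRestrict.mp h₂).subtype_mk _)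
    (funext fun x => hlift x x.2) ⟨x₀, hx₀⟩ (Subtype.ext heq)
  exact fun x hx => congrArg Subtype.val (congrFun hG ⟨x, hx⟩)

section PathLifting

variable {c : ℝ → ℂ} (hcL : ∀ s, Real.exp L < ‖c s‖) {z₀ : ℂ}
include hcL

theorem eqOn_of_isPathLift {a : ℝ} {Γ₁ Γ₂ : ℝ → ℂ} (h₁ : IsPathLift F c z₀ (Iic a) Γ₁)
    (h₂ : IsPathLift F c z₀ (Iic a) Γ₂) : EqOn Γ₁ Γ₂ (Iic a) := by
  have hmem : min a 0 ∈ Iic a := mem_Iic.mpr (min_le_left _ _)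
  refine hF.eqOn_of_lift isPreconnected_Iic h₁.continuousOn h₂.continuousOn
    (fun x hx => ?_) (fun x hx => ?_) hmem ?_
  · rw [h₁.map_eq x hx, h₂.map_eq x hx]
  · rw [h₁.map_eq x hx]; exact hcL x
  · rw [h₁.eq_base _ hmem (min_le_right _ _), h₂.eq_base _ hmem (min_le_right _ _)]

theorem exists_isPathLift_Iio {σ : ℝ} (h : ∀ a < σ, ∃ Γ, IsPathLift F c z₀ (Iic a) Γ) :
    ∃ Γ, IsPathLift F c z₀ (Iio σ) Γ := by
  choose! Γ hΓ using h
  have hdiag : ∀ a < σ, EqOn (fun x => Γ x x) (Γ a) (Iic a) := fun a ha x hx =>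
    have hxσ : x < σ := lt_of_le_of_lt hx ha
    hF.eqOn_of_isPathLift hcL (hΓ x hxσ) ((hΓ a ha).mono (Iic_subset_Iic.mpr hx)) self_mem_Iic
  refine ⟨fun x => Γ x x, fun x hx => ?_, fun x hx => (hΓ x hx).eq_base x self_mem_Iic,
    fun x hx => (hΓ x hx).map_eq x self_mem_Iic⟩
  obtain ⟨b, hxb, hb⟩ := exists_between (mem_Iio.mp hx)
  have hcont : ContinuousOn (fun x => Γ x x) (Iic b) := (hΓ b hb).continuousOn.congr (hdiag b hb)
  exact (hcont.continuousAt (Iic_mem_nhds hxb)).continuousWithinAt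

variable (hc : Continuous c)
include hc

-- Otherwise the lift, run towards `σ` in infinite time, is an asymptotic curve of value `c σ`.
theorem exists_mapClusterPt_of_isPathLift {σ : ℝ} {Γ : ℝ → ℂ}
    (hΓ : IsPathLift F c z₀ (Iio σ) Γ) : ∃ z, MapClusterPt z (𝓝[<] σ) Γ ∧ F z = c σ := by
  have hlim : Tendsto (fun x => F (Γ x)) (𝓝[<] σ) (𝓝 (c σ)) := by
    refine (hc.continuousAt.tendsto.mono_left nhdsWithin_le_nhds).congr' ?_
    filter_upwards [self_mem_nhdsWithin] with x hx
    exact (hΓ.map_eq x hx).symm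
  have htime : Tendsto (fun t : ℝ => σ - Real.exp (-t)) atTop (𝓝[<] σ) :=
    tendsto_nhdsWithin_iff.mpr
      ⟨by simpa using Real.tendsto_exp_neg_atTop_nhds_zero.const_sub σ,
        .of_forall fun t => sub_lt_self σ (Real.exp_pos _)⟩
  have hnot : ¬ Tendsto Γ (𝓝[<] σ) (cocompact ℂ) := fun htend =>
    hF.not_asymptotic (c σ) (fun t => Γ (σ - Real.exp (-t))) (hcL σ)
      (hΓ.continuousOn.comp (by fun_prop) fun t _ => sub_lt_self σ (Real.exp_pos _))
      (htend.comp htime) (hlim.comp htime)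
  obtain ⟨z, hz⟩ := exists_mapClusterPt_of_not_tendsto_cocompact hnot
  have hc0 : c σ ≠ 0 := norm_pos_iff.mp ((Real.exp_pos L).trans (hcL σ))
  exact ⟨z, hz, eq_of_mapClusterPt (hF.normalForm z) hc0 hz hlim⟩

variable (hconst : ∀ s ≤ 0, c s = c 0)
include hconst

theorem exists_isPathLift_gt {σ : ℝ} {Γ : ℝ → ℂ} (hΓ : IsPathLift F c z₀ (Iio σ) Γ) :
    ∃ b > σ, ∃ Γ', IsPathLift F c z₀ (Iic b) Γ' := by
  obtain ⟨z, hz, hFz⟩ := hF.exists_mapClusterPt_of_isPathLift hcL hc hΓ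
  obtain ⟨e, hez, heF⟩ := hF.exists_openPartialHomeomorph (z := z) (by rw [hFz]; exact hcL σ)
  have hσ : c σ ∈ e.target := by rw [← hFz, ← heF]; exact e.map_source hez
  obtain ⟨δ, hδ, hball⟩ := Metric.isOpen_iff.mp (e.open_target.preimage hc) σ hσ
  obtain ⟨a, hae, ha⟩ := ((mapClusterPt_iff_frequently.mp hz _
    (e.open_source.mem_nhds hez)).and_eventually
    (Ioo_mem_nhdsLT (sub_lt_self σ hδ))).exists
  have htarget : ∀ x ∈ Icc a (σ + δ / 2), c x ∈ e.target := fun x hx => hball (by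
    rw [Metric.mem_ball, Real.dist_eq, abs_lt]
    constructor <;> linarith [hx.1, hx.2, ha.1])
  have hsymm : e.symm (c a) = Γ a := by
    rw [← hΓ.map_eq a ha.2, ← heF, e.left_inv hae]
  let Γ' : ℝ → ℂ := fun x => if x ≤ a then Γ x else e.symm (c x)
  have hleft : EqOn Γ' Γ (Iic a) := fun x hx => if_pos hx
  have hright : ∀ x ∈ Icc a (σ + δ / 2), Γ' x = e.symm (c x) := fun x hx => by
    rcases hx.1.eq_or_lt with rfl | hlt
    · exact (if_pos le_rfl).trans hsymm.symm
    · exact if_neg hlt.not_ge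
  refine ⟨σ + δ / 2, by linarith, Γ', ?_, fun x hx hx0 => ?_, fun x hx => ?_⟩
  · have haσ : a ≤ σ + δ / 2 := by linarith [ha.2]
    rw [← Iic_union_Icc_eq_Iic haσ]
    refine ContinuousOn.union_of_isClosed ((hΓ.continuousOn.mono ?_).congr hleft)
      ((e.continuousOn_symm.comp hc.continuousOn htarget).congr hright) isClosed_Iic isClosed_Icc
    exact Iic_subset_Iio.mpr ha.2
  all_goals rcases le_total x a with hxa | hxa
  · rw [hleft hxa, hΓ.eq_base x (hxa.trans_lt ha.2) hx0]
  · have ha0 : a ≤ 0 := hxa.trans hx0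
    rw [hright x ⟨hxa, hx⟩, hconst x hx0, ← hconst a ha0, hsymm, hΓ.eq_base a ha.2 ha0]
  · rw [hleft hxa, hΓ.map_eq x (hxa.trans_lt ha.2)]
  · rw [hright x ⟨hxa, hx⟩, ← heF, e.right_inv (htarget x ⟨hxa, hx⟩)]

theorem exists_isPathLift (hz₀ : F z₀ = c 0) (s : ℝ) : ∃ Γ, IsPathLift F c z₀ (Iic s) Γ := by
  set S : Set ℝ := {a | ∃ Γ, IsPathLift F c z₀ (Iic a) Γ}
  have hdown : ∀ a ∈ S, ∀ b ≤ a, b ∈ S := fun a ⟨Γ, hΓ⟩ b hb =>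
    ⟨Γ, hΓ.mono (Iic_subset_Iic.mpr hb)⟩
  have hzero : (0 : ℝ) ∈ S := ⟨fun _ => z₀, continuousOn_const, fun _ _ _ => rfl,
    fun x hx => by rw [hz₀, hconst x hx]⟩
  by_contra hs
  have hbdd : BddAbove S := ⟨s, fun a ha => le_of_not_gt fun h => hs (hdown a ha s h.le)⟩
  have hlt : ∀ a < sSup S, a ∈ S := fun a ha => by
    obtain ⟨b, hb, hab⟩ := exists_lt_of_lt_csSup ⟨0, hzero⟩ ha
    exact hdown b hb a hab.le
  obtain ⟨Γ, hΓ⟩ := hF.exists_isPathLift_Iio hcL hlt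
  obtain ⟨b, hb, hbS⟩ := hF.exists_isPathLift_gt hcL hc hconst hΓ
  exact hb.not_ge (le_csSup hbdd hbS)

end PathLifting

theorem continuousOn_of_isPathLift {A : Set ℂ} {c Γ : ℂ → ℝ → ℂ} {z₀ : ℂ}
    (hc : Continuous fun p : ℝ × ℂ => c p.2 p.1) (hcL : ∀ ζ ∈ A, ∀ s, Real.exp L < ‖c ζ s‖)
    (hΓ : ∀ ζ ∈ A, IsPathLift F (c ζ) z₀ (Iic 1) (Γ ζ)) : ContinuousOn (fun ζ => Γ ζ 1) A := by
  let g : unitInterval × A → {z | Real.exp L < ‖F z‖} := fun x => ⟨Γ x.2 x.1, by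
    rw [mem_ofPred_eq, (hΓ x.2 x.2.2).map_eq x.1 x.1.2.2]
    exact hcL _ x.2.2 _⟩
  let f : C(unitInterval × A, ℂ) := ⟨fun x => c x.2 x.1,
    hc.comp ((continuous_subtype_val.comp continuous_fst).prodMk
      (continuous_subtype_val.comp continuous_snd))⟩
  have hinit : Continuous fun ζ : A => g (0, ζ) := by
    have : (fun ζ : A => g (0, ζ)) = fun ζ => ⟨z₀, by
        have hζ := (hΓ ζ ζ.2).eq_base 0 (mem_Iic.mpr zero_le_one) le_rfl
        rw [mem_ofPred_eq, ← hζ, (hΓ ζ ζ.2).map_eq 0 (mem_Iic.mpr zero_le_one)]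
        exact hcL ζ ζ.2 0⟩ :=
      funext fun ζ => Subtype.ext ((hΓ ζ ζ.2).eq_base _ (mem_Iic.mpr zero_le_one) le_rfl)
    rw [this]
    exact continuous_const.subtype_mk _
  have hg : Continuous g := hF.isLocalHomeomorph.continuous_lift (T2Space.isSeparatedMap _) f
    (funext fun x => (hΓ x.2 x.2.2).map_eq x.1 x.1.2.2) hinit fun ζ =>
      ((hΓ ζ ζ.2).continuousOn.comp_continuous continuous_subtype_val fun t => t.2.2).subtype_mk _
  rw [continuousOn_iff_continuous_domRestrict]
  exact continuous_subtype_val.comp (hg.comp (Continuous.prodMk_right (1 : unitInterval)))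

theorem exists_isLogInverse {z₀ ζ₀ : ℂ} (hζ₀ : ζ₀ ∈ rightHalfPlane L)
    (hz₀ : F z₀ = Complex.exp ζ₀) : ∃ ψ : ℂ → ℂ, IsLogInverse F L ψ ∧ ψ ζ₀ = z₀ := by
  let segment : ℂ → ℝ → ℂ := fun ζ s =>
    AffineMap.lineMap ζ₀ ζ (projIcc (0 : ℝ) 1 zero_le_one s : ℝ)
  let c : ℂ → ℝ → ℂ := fun ζ s => Complex.exp (segment ζ s)
  have hstart : ∀ ζ, ∀ s ≤ 0, segment ζ s = ζ₀ := fun ζ s hs => by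
    simp [segment, projIcc_of_le_left zero_le_one hs]
  have hend : ∀ ζ, segment ζ 1 = ζ := fun ζ => by simp [segment]
  have hcont : Continuous fun p : ℝ × ℂ => c p.2 p.1 := by
    simp only [c, segment, AffineMap.lineMap_apply_module]
    fun_prop
  have hcL : ∀ ζ ∈ rightHalfPlane L, ∀ s, Real.exp L < ‖c ζ s‖ := fun ζ hζ s =>
    exp_lt_norm_exp <| (convex_rightHalfPlane L).lineMap_mem hζ₀ hζ (projIcc 0 1 zero_le_one s).2
  have hlift : ∀ ζ ∈ rightHalfPlane L, ∃ Γ, IsPathLift F (c ζ) z₀ (Iic 1) Γ := fun ζ hζ =>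
    hF.exists_isPathLift (hcL ζ hζ) (by fun_prop)
      (fun s hs => congrArg Complex.exp ((hstart ζ s hs).trans (hstart ζ 0 le_rfl).symm))
      (hz₀.trans (congrArg Complex.exp (hstart ζ 0 le_rfl)).symm) 1
  choose! Γ hΓ using hlift
  have hone : (1 : ℝ) ∈ Iic 1 := mem_Iic.mpr le_rfl
  refine ⟨fun ζ => Γ ζ 1, ⟨hF.continuousOn_of_isPathLift hcont hcL hΓ, fun ζ hζ => ?_⟩, ?_⟩
  · simp only [(hΓ ζ hζ).map_eq 1 hone, c, hend]
  · have hstay : IsPathLift F (c ζ₀) z₀ (Iic 1) fun _ => z₀ :=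
      ⟨continuousOn_const, fun _ _ _ => rfl, fun x _ => by simp [c, segment, hz₀]⟩
    exact hF.eqOn_of_isPathLift (hcL ζ₀ hζ₀) (hΓ ζ₀ hζ₀) hstay hone

end UnramifiedAbove

namespace IsLogInverse

variable {F ψ : ℂ → ℂ} {L : ℝ} (hψ : IsLogInverse F L ψ) (hF : UnramifiedAbove F L)
include hψ

theorem exp_lt_norm {ζ : ℂ} (hζ : ζ ∈ rightHalfPlane L) : Real.exp L < ‖F (ψ ζ)‖ := by
  rw [hψ.map_eq ζ hζ]
  exact exp_lt_norm_exp hζ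

include hF

theorem differentiableOn : DifferentiableOn ℂ ψ (rightHalfPlane L) := by
  intro ζ hζ
  have hlarge := hψ.exp_lt_norm hζ
  have hstrict := (hF.analyticAt hlarge).hasStrictDerivAt
  have hne := hF.deriv_ne_zero _ hlarge
  have hcont : ContinuousAt ψ ζ :=
    hψ.continuousOn.continuousAt ((isOpen_rightHalfPlane L).mem_nhds hζ)
  have hlocal : (fun ξ => hstrict.localInverse F _ _ hne (Complex.exp ξ)) =ᶠ[𝓝 ζ] ψ := by
    filter_upwards [hcont.eventually (hstrict.eventually_left_inverse hne),
      (isOpen_rightHalfPlane L).mem_nhds hζ] with ξ hξ hξL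
    rw [← hψ.map_eq ξ hξL, hξ]
  have hderiv : HasDerivAt (hstrict.localInverse F _ _ hne) (deriv F (ψ ζ))⁻¹ (Complex.exp ζ) := by
    rw [← hψ.map_eq ζ hζ]
    exact (hstrict.to_localInverse hne).hasDerivAt
  exact ((hderiv.comp ζ (Complex.hasDerivAt_exp ζ)).congr_of_eventuallyEq
    hlocal.symm).differentiableAt.differentiableWithinAt

end IsLogInverse

/-! ### Tracts -/

theorem subset_of_disjoint_frontier {X : Type*} [TopologicalSpace X] {s t : Set X}
    (ht : IsPreconnected t) (hs : IsOpen s) (hne : (t ∩ s).Nonempty)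
    (hdisj : Disjoint t (frontier s)) : t ⊆ s := by
  refine ht.subset_left_of_subset_union hs isClosed_closure.isOpen_compl
    (disjoint_compl_right.mono_left subset_closure) (fun x hx => ?_) hne
  by_cases hxs : x ∈ s
  · exact Or.inl hxs
  · refine Or.inr fun hcl => hdisj.notMem_of_mem_left hx ?_
    exact hs.frontier_eq ▸ ⟨hcl, hxs⟩

theorem isPreconnected_setOf_dist_mem (c : ℂ) {s : Set ℝ} (hs : s.OrdConnected)
    (hs0 : s ⊆ Ici 0) : IsPreconnected {z | dist z c ∈ s} := by
  have himage : {z | dist z c ∈ s} = (fun p : ℝ × ℝ => circleMap c p.1 p.2) '' s ×ˢ univ := by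
    ext z
    constructor
    · intro hz
      refine ⟨(dist z c, (z - c).arg), ⟨hz, mem_univ _⟩, ?_⟩
      simp only [circleMap, dist_eq_norm, Complex.norm_mul_exp_arg_mul_I, add_sub_cancel]
    · rintro ⟨⟨r, θ⟩, ⟨hr, -⟩, rfl⟩
      have hdist : dist (circleMap c r θ) c = r := by
        rw [dist_eq_norm, circleMap_sub_center, norm_circleMap_zero, abs_of_nonneg (hs0 hr)]
      rwa [mem_ofPred_eq, hdist]
  rw [himage]
  exact (hs.isPreconnected.prod isPreconnected_univ).image _ (by unfold circleMap; fun_prop)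

theorem isPreconnected_setOf_lt_norm {K : ℝ} (hK : 0 ≤ K) : IsPreconnected {z : ℂ | K < ‖z‖} := by
  simpa only [dist_zero_right, mem_Ioi] using isPreconnected_setOf_dist_mem 0 (s := Ioi K)
    ordConnected_Ioi (Ioi_subset_Ici hK)

theorem isPreconnected_ball_diff_center (c : ℂ) (δ : ℝ) : IsPreconnected (ball c δ \ {c}) := by
  have hset : ball c δ \ {c} = {z | dist z c ∈ Ioo 0 δ} := by
    ext z
    simp only [Set.mem_sdiff, mem_ball, mem_singleton_iff, mem_ofPred_eq, mem_Ioo, dist_pos]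
    exact and_comm
  exact hset ▸ isPreconnected_setOf_dist_mem c ordConnected_Ioo fun r hr => hr.1.le

theorem eventually_mem_rightHalfPlane (T : ℝ) :
    ∀ᶠ ζ : ℂ in comap Complex.re atTop, ζ ∈ rightHalfPlane T :=
  tendsto_comap.eventually_gt_atTop T

instance neBot_comap_re_atTop : (comap Complex.re atTop).NeBot :=
  comap_neBot_iff_frequently.mpr (Frequently.of_forall fun x => ⟨x, Complex.ofReal_re x⟩)

theorem not_mapClusterPt_of_tendsto_cocompact {X : Type*} {l : Filter X} {G : X → ℂ}
    (htend : Tendsto G l (cocompact ℂ)) (z : ℂ) : ¬ MapClusterPt z l G := fun hz => by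
  obtain ⟨ζ, hmem, hnotMem⟩ := ((mapClusterPt_iff_frequently.mp hz _
    (closedBall_mem_nhds z one_pos)).and_eventually
    (htend.eventually (isCompact_closedBall z 1).compl_mem_cocompact)).exists
  exact hnotMem hmem

theorem add_mul_I_mem_rightHalfPlane {L : ℝ} {ζ : ℂ} (hζ : ζ ∈ rightHalfPlane L) (n : ℤ) :
    ζ + n * (2 * π * Complex.I) ∈ rightHalfPlane L := by
  simpa [rightHalfPlane] using hζ

namespace IsLogInverse

variable {F ψ : ℂ → ℂ} {L : ℝ} (hψ : IsLogInverse F L ψ) (hF : UnramifiedAbove F L)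
include hψ

theorem ne_zero {ζ : ℂ} (hζ : ζ ∈ rightHalfPlane L) : F (ψ ζ) ≠ 0 := by
  rw [hψ.map_eq ζ hζ]
  exact Complex.exp_ne_zero ζ

theorem norm_eq {ζ : ℂ} (hζ : ζ ∈ rightHalfPlane L) : ‖F (ψ ζ)‖ = Real.exp ζ.re := by
  rw [hψ.map_eq ζ hζ, Complex.norm_exp]

include hF

theorem deriv_ne_zero {ζ : ℂ} (hζ : ζ ∈ rightHalfPlane L) : deriv ψ ζ ≠ 0 := by
  have hnhds : rightHalfPlane L ∈ 𝓝 ζ := (isOpen_rightHalfPlane L).mem_nhds hζ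
  have hcomp := (hF.analyticAt (hψ.exp_lt_norm hζ)).differentiableAt.hasDerivAt.comp ζ
    ((hψ.differentiableOn hF).differentiableAt hnhds).hasDerivAt
  have hexp : HasDerivAt (F ∘ ψ) (Complex.exp ζ) ζ :=
    (Complex.hasDerivAt_exp ζ).congr_of_eventuallyEq (eventually_of_mem hnhds hψ.map_eq)
  exact right_ne_zero_of_mul (hexp.unique hcomp ▸ Complex.exp_ne_zero ζ)

theorem isOpen_image {U : Set ℂ} (hU : IsOpen U) (hUL : U ⊆ rightHalfPlane L) :
    IsOpen (ψ '' U) := by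
  rw [isOpen_iff_mem_nhds]
  rintro _ ⟨ζ, hζ, rfl⟩
  have han : AnalyticAt ℂ ψ ζ :=
    (hψ.differentiableOn hF).analyticAt ((isOpen_rightHalfPlane L).mem_nhds (hUL hζ))
  rw [← han.hasStrictDerivAt.map_nhds_eq (hψ.deriv_ne_zero hF (hUL hζ))]
  exact image_mem_map (hU.mem_nhds hζ)

theorem exists_int_eq_add {φ : ℂ → ℂ} (hφ : IsLogInverse F L φ) {ζ ω : ℂ}
    (hζ : ζ ∈ rightHalfPlane L) (hω : ω ∈ rightHalfPlane L) (h : ψ ζ = φ ω) :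
    ∃ n : ℤ, ω = ζ + n * (2 * π * Complex.I) ∧
      ∀ ξ ∈ rightHalfPlane L, ψ ξ = φ (ξ + n * (2 * π * Complex.I)) := by
  have hexp : Complex.exp ω = Complex.exp ζ := by
    rw [← hψ.map_eq ζ hζ, ← hφ.map_eq ω hω, h]
  obtain ⟨n, hn⟩ := Complex.exp_eq_exp_iff_exists_int.mp hexp
  refine ⟨n, hn, hF.eqOn_of_lift (convex_rightHalfPlane L).isPreconnected hψ.continuousOn
    (hφ.continuousOn.comp (by fun_prop) fun ξ hξ => add_mul_I_mem_rightHalfPlane hξ n)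
    (fun ξ hξ => ?_) (fun ξ hξ => hψ.exp_lt_norm hξ) hζ (hn ▸ h)⟩
  rw [hψ.map_eq ξ hξ, hφ.map_eq _ (add_mul_I_mem_rightHalfPlane hξ n), Complex.exp_add,
    Complex.exp_int_mul_two_pi_mul_I, mul_one]

-- A branch `φ` through `z` meets the image of `ψ`, hence differs from `ψ` by a translation only.
theorem mem_image_of_mem_closure {L' : ℝ} (hL' : L < L') {z : ℂ}
    (hz : z ∈ closure (ψ '' {ζ | L' ≤ ζ.re})) (han : AnalyticAt ℂ F z) :
    z ∈ ψ '' {ζ | L' ≤ ζ.re} := by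
  have hsub : {ζ : ℂ | L' ≤ ζ.re} ⊆ rightHalfPlane L := fun ζ hζ => lt_of_lt_of_le hL' hζ
  have hnorm : Real.exp L' ≤ ‖F z‖ := by
    refine ContinuousWithinAt.closure_le hz continuousWithinAt_const
      han.continuousAt.norm.continuousWithinAt ?_
    rintro _ ⟨ζ, hζ, rfl⟩
    rw [hψ.norm_eq (hsub hζ)]
    exact Real.exp_le_exp.mpr hζ
  have hFz : F z ≠ 0 := norm_pos_iff.mp ((Real.exp_pos L').trans_le hnorm)
  have hω : L' ≤ (Complex.log (F z)).re := by
    rwa [Complex.log_re, Real.le_log_iff_exp_le (norm_pos_iff.mpr hFz)]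
  obtain ⟨φ, hφ, hφz⟩ := hF.exists_isLogInverse (hsub hω) (Complex.exp_log hFz).symm
  have hnhds : φ '' rightHalfPlane L ∈ 𝓝 z :=
    (hφ.isOpen_image hF (isOpen_rightHalfPlane L) subset_rfl).mem_nhds ⟨_, hsub hω, hφz⟩
  obtain ⟨_, ⟨ξ, hξ, heq⟩, ζ, hζ, rfl⟩ := mem_closure_iff_nhds.mp hz _ hnhds
  obtain ⟨n, -, hn⟩ := hφ.exists_int_eq_add hF hψ hξ (hsub hζ) heq
  exact ⟨Complex.log (F z) + n * (2 * π * Complex.I), by simpa using hω,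
    (hn _ (hsub hω)).symm.trans hφz⟩

theorem mapClusterPt_of_mem_closure {L' : ℝ} (hL' : L < L') {z : ℂ}
    (hz : z ∈ closure (ψ '' {ζ | L' ≤ ζ.re})) (han : ¬ AnalyticAt ℂ F z) :
    MapClusterPt z (comap Complex.re atTop) ψ := by
  rw [mapClusterPt_iff_frequently]
  intro U hU
  rw [(atTop_basis_Ioi.comap Complex.re).frequently_iff]
  intro T _
  have hlarge := eventually_eq_zero_or_lt_norm (hF.normalForm z) han (Real.exp T)
  obtain ⟨y, ⟨hyU, hy⟩, ζ, hζ, rfl⟩ := mem_closure_iff_nhds.mp hz _ (inter_mem hU hlarge)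
  have hζL : ζ ∈ rightHalfPlane L := lt_of_lt_of_le hL' hζ
  have hT : Real.exp T < ‖F (ψ ζ)‖ := hy.resolve_left (hψ.ne_zero hζL)
  rw [hψ.norm_eq hζL, Real.exp_lt_exp] at hT
  exact ⟨ζ, hT, hyU⟩

theorem frontier_image_subset {L' : ℝ} (hL' : L < L') {z : ℂ}
    (hz : z ∈ frontier (ψ '' rightHalfPlane L')) :
    (∃ ζ, ζ.re = L' ∧ ψ ζ = z) ∨
      ¬ AnalyticAt ℂ F z ∧ MapClusterPt z (comap Complex.re atTop) ψ := by
  have hopen := hψ.isOpen_image hF (isOpen_rightHalfPlane L') (rightHalfPlane_subset hL'.le)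
  rw [hopen.frontier_eq] at hz
  have hcl : z ∈ closure (ψ '' {ζ | L' ≤ ζ.re}) :=
    closure_mono (image_mono (show rightHalfPlane L' ⊆ {ζ | L' ≤ ζ.re} from
      fun ζ (hζ : L' < ζ.re) => hζ.le)) hz.1
  by_cases han : AnalyticAt ℂ F z
  · obtain ⟨ζ, hζ, rfl⟩ := hψ.mem_image_of_mem_closure hF hL' hcl han
    exact Or.inl ⟨ζ, (hζ.eq_of_not_lt fun h => hz.2 ⟨ζ, h, rfl⟩).symm, rfl⟩
  · exact Or.inr ⟨han, hψ.mapClusterPt_of_mem_closure hF hL' hcl han⟩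

omit hF in
theorem exists_forall_lt_norm (K : ℝ) : ∃ T ≥ L, ∀ ζ ∈ rightHalfPlane T, K < ‖F (ψ ζ)‖ := by
  refine ⟨max L (Real.log (max K 1)), le_max_left _ _, fun ζ hζ => ?_⟩
  have hζK : Real.log (max K 1) < ζ.re := (le_max_right _ _).trans_lt hζ
  rw [hψ.norm_eq (rightHalfPlane_subset (le_max_left _ _) hζ)]
  exact (le_max_left K 1).trans_lt ((Real.log_lt_iff_lt_exp (by positivity)).mp hζK)

omit hF in
theorem not_analyticAt_of_mapClusterPt {z : ℂ}
    (hz : MapClusterPt z (comap Complex.re atTop) ψ) : ¬ AnalyticAt ℂ F z := by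
  intro han
  have hbdd : ∀ᶠ y in 𝓝 z, ‖F y‖ < ‖F z‖ + 1 :=
    han.continuousAt.norm.eventually_lt_const (by linarith)
  obtain ⟨T, -, hT⟩ := hψ.exists_forall_lt_norm (‖F z‖ + 1)
  obtain ⟨ζ, hζ, hζT⟩ := ((mapClusterPt_iff_frequently.mp hz _ hbdd).and_eventually
    (eventually_mem_rightHalfPlane T)).exists
  exact lt_asymm hζ (hT ζ hζT)

-- `F` is bounded on a small circle around `z`, so the image of a far half plane, being connected,
-- cannot cross it.
theorem tendsto_nhds_of_mapClusterPt {z : ℂ} (hz : MapClusterPt z (comap Complex.re atTop) ψ) :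
    Tendsto ψ (comap Complex.re atTop) (𝓝 z) := by
  rw [nhds_basis_ball.tendsto_right_iff]
  intro ε hε
  have hpunct := (hF.normalForm z).meromorphicAt.eventually_analyticAt
  obtain ⟨δ₀, hδ₀, hball⟩ :=
    Metric.eventually_nhds_iff_ball.mp (eventually_nhdsWithin_iff.mp hpunct)
  obtain ⟨δ, hδ, hδlt⟩ := exists_between (lt_min hδ₀ hε)
  have hcont : ContinuousOn F (sphere z δ) := fun y hy =>
    (hball y (sphere_subset_ball (hδlt.trans_le (min_le_left _ _)) hy)
      (ne_of_mem_sphere hy hδ.ne')).continuousAt.continuousWithinAt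
  obtain ⟨K, hK⟩ := (isCompact_sphere z δ).exists_bound_of_continuousOn hcont
  obtain ⟨T, hTL, hT⟩ := hψ.exists_forall_lt_norm K
  have hsub : ψ '' rightHalfPlane T ⊆ ball z δ := by
    refine subset_of_disjoint_frontier ((convex_rightHalfPlane T).isPreconnected.image _
      (hψ.continuousOn.mono (rightHalfPlane_subset hTL))) isOpen_ball ?_ ?_
    · obtain ⟨ζ, hζ, hζT⟩ := ((mapClusterPt_iff_frequently.mp hz _
        (ball_mem_nhds z hδ)).and_eventually (eventually_mem_rightHalfPlane T)).exists
      exact ⟨ψ ζ, ⟨ζ, hζT, rfl⟩, hζ⟩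
    · refine Set.disjoint_left.mpr ?_
      rintro _ ⟨ζ, hζ, rfl⟩ hfr
      exact (hT ζ hζ).not_ge (hK _ (frontier_ball_subset_sphere hfr))
  filter_upwards [eventually_mem_rightHalfPlane T] with ζ hζ
  exact ball_subset_ball (hδlt.le.trans (min_le_right _ _)) (hsub ⟨ζ, hζ, rfl⟩)

theorem tendsto_cocompact_or :
    Tendsto ψ (comap Complex.re atTop) (cocompact ℂ) ∨
      ∃ z, ¬ AnalyticAt ℂ F z ∧ Tendsto ψ (comap Complex.re atTop) (𝓝 z) := by
  refine or_iff_not_imp_left.mpr fun h => ?_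
  obtain ⟨z, hz⟩ := exists_mapClusterPt_of_not_tendsto_cocompact h
  exact ⟨z, hψ.not_analyticAt_of_mapClusterPt hz, hψ.tendsto_nhds_of_mapClusterPt hF hz⟩

theorem tendsto_cocompact_add_int_mul (hinj : InjOn ψ (rightHalfPlane L)) {ζ : ℂ}
    (hζ : ζ ∈ rightHalfPlane L) :
    Tendsto (fun n : ℤ => ψ (ζ + n * (2 * π * Complex.I))) cofinite (cocompact ℂ) := by
  by_contra hnot
  obtain ⟨y, hy⟩ := exists_mapClusterPt_of_not_tendsto_cocompact hnot
  have hmem := fun n : ℤ => add_mul_I_mem_rightHalfPlane hζ n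
  have hval : ∀ n : ℤ, F (ψ (ζ + n * (2 * π * Complex.I))) = Complex.exp ζ := fun n => by
    rw [hψ.map_eq _ (hmem n), Complex.exp_add, Complex.exp_int_mul_two_pi_mul_I, mul_one]
  have hFy : F y = Complex.exp ζ := eq_of_mapClusterPt (hF.normalForm y) (Complex.exp_ne_zero ζ) hy
    (tendsto_const_nhds.congr fun n => (hval n).symm)
  obtain ⟨e, hey, heF⟩ := hF.exists_openPartialHomeomorph (hFy ▸ exp_lt_norm_exp hζ)
  have hfreq := mapClusterPt_iff_frequently.mp hy _ (e.open_source.mem_nhds hey)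
  obtain ⟨m, hm⟩ := hfreq.exists
  obtain ⟨n, hn, hmn⟩ := (hfreq.and_eventually (eventually_cofinite_ne m)).exists
  have heq := hinj (hmem n) (hmem m) (e.injOn hn hm (by rw [heF, hval, hval]))
  refine hmn ?_
  simpa [Real.pi_ne_zero] using heq

theorem tendsto_cocompact_of_injOn (hinj : InjOn ψ (rightHalfPlane L)) :
    Tendsto ψ (comap Complex.re atTop) (cocompact ℂ) := by
  refine (hψ.tendsto_cocompact_or hF).resolve_right ?_
  rintro ⟨z, -, hz⟩
  obtain ⟨T, -, hT⟩ := (atTop_basis_Ioi.comap Complex.re).eventually_iff.mp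
    ((hz.eventually (closedBall_mem_nhds z one_pos)).and (eventually_mem_rightHalfPlane L))
  have hT1 : ((T + 1 : ℝ) : ℂ) ∈ Complex.re ⁻¹' Ioi T := by simp
  obtain ⟨n, hn⟩ := ((hψ.tendsto_cocompact_add_int_mul hF hinj (hT hT1).2).eventually
    (isCompact_closedBall z 1).compl_mem_cocompact).exists
  exact hn (hT (add_mul_I_mem_rightHalfPlane hT1 n)).1

end IsLogInverse

/-! ### Injectivity -/

namespace IsLogInverse

variable {F ψ : ℂ → ℂ} {L L' : ℝ} {z : ℂ} (hψ : IsLogInverse F L ψ) (hF : UnramifiedAbove F L)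
include hψ

theorem isBounded_image_strip {p a b : ℝ} (hp : 0 < p)
    (hper : ∀ x > L, Function.Periodic (fun y : ℝ => ψ (x + y * Complex.I)) p) (ha : L < a) :
    Bornology.IsBounded (ψ '' {ζ | a ≤ ζ.re ∧ ζ.re ≤ b}) := by
  have hcompact : IsCompact (Icc a b ×ℂ Icc 0 p) := isCompact_Icc.reProdIm isCompact_Icc
  have hsub : Icc a b ×ℂ Icc 0 p ⊆ rightHalfPlane L := fun ζ hζ => lt_of_lt_of_le ha hζ.1.1
  refine (hcompact.image_of_continuousOn (hψ.continuousOn.mono hsub)).isBounded.subset ?_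
  rintro _ ⟨ζ, hζ, rfl⟩
  obtain ⟨y, hy, heq⟩ := (hper ζ.re (ha.trans_le hζ.1)).exists_mem_Ico₀ hp ζ.im
  refine ⟨ζ.re + y * Complex.I, ?_, by simpa only [Complex.re_add_im] using heq.symm⟩
  simpa [Complex.mem_reProdIm] using ⟨hζ, hy.1, hy.2.le⟩

include hF

theorem exists_period (hinj : ¬ InjOn ψ (rightHalfPlane L)) :
    ∃ p > 0, ∀ x > L, Function.Periodic (fun y : ℝ => ψ (x + y * Complex.I)) p := by
  simp only [InjOn, not_forall] at hinj
  obtain ⟨ζ, hζ, ω, hω, heq, hne⟩ := hinj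
  obtain ⟨n, hn, hper⟩ := hψ.exists_int_eq_add hF hψ hζ hω heq
  have hn0 : n ≠ 0 := by
    rintro rfl
    exact hne (by simpa using hn.symm)
  have hperiodic : ∀ x > L,
      Function.Periodic (fun y : ℝ => ψ (x + y * Complex.I)) (n * (2 * π)) := fun x hx y => by
    have hmem : (x + y * Complex.I : ℂ) ∈ rightHalfPlane L := by simpa [rightHalfPlane] using hx
    refine ((hper _ hmem).trans (congrArg ψ ?_)).symm
    push_cast
    ring
  refine ⟨|n * (2 * π)|, abs_pos.mpr (by positivity), fun x hx => ?_⟩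
  rcases abs_choice (n * (2 * π)) with h | h <;> rw [h]
  · exact hperiodic x hx
  · exact (hperiodic x hx).neg

theorem exists_lt_norm_subset_image {p : ℝ} (hp : 0 < p)
    (hper : ∀ x > L, Function.Periodic (fun y : ℝ => ψ (x + y * Complex.I)) p) (hL' : L < L')
    (hlim : Tendsto ψ (comap Complex.re atTop) (cocompact ℂ)) :
    ∃ K, {z : ℂ | K < ‖z‖} ⊆ ψ '' rightHalfPlane L' := by
  obtain ⟨K, hK, hline⟩ := (hψ.isBounded_image_strip hp hper (b := L') hL').exists_pos_norm_le
  refine ⟨K, subset_of_disjoint_frontier (isPreconnected_setOf_lt_norm hK.le)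
    (hψ.isOpen_image hF (isOpen_rightHalfPlane L') (rightHalfPlane_subset hL'.le)) ?_ ?_⟩
  · obtain ⟨ζ, hζK, hζ⟩ := ((hlim.eventually
      (isCompact_closedBall (0 : ℂ) K).compl_mem_cocompact).and
      (eventually_mem_rightHalfPlane L')).exists
    exact ⟨ψ ζ, by simpa using hζK, ζ, hζ, rfl⟩
  · refine Set.disjoint_left.mpr fun y hy hfr => ?_
    rcases hψ.frontier_image_subset hF hL' hfr with ⟨ζ, hζ, rfl⟩ | ⟨-, hy'⟩
    · exact (hline _ ⟨ζ, ⟨hζ.ge, hζ.le⟩, rfl⟩).not_gt hy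
    · exact not_mapClusterPt_of_tendsto_cocompact hlim y hy'

theorem eq_or_norm_eq_of_mem_frontier (hL' : L < L')
    (hlim : Tendsto ψ (comap Complex.re atTop) (𝓝 z)) {y : ℂ}
    (hy : y ∈ frontier (ψ '' rightHalfPlane L')) : y = z ∨ ‖F y‖ = Real.exp L' := by
  rcases hψ.frontier_image_subset hF hL' hy with ⟨ζ, hζ, rfl⟩ | ⟨-, hcluster⟩
  · exact Or.inr (by rw [hψ.norm_eq (show L < ζ.re from hL'.trans_eq hζ.symm), hζ])
  · exact Or.inl (eq_of_nhds_neBot (ClusterPt.mono hcluster hlim).neBot)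

theorem isOpen_image_union_singleton (hL' : L < L') (hz : ¬ AnalyticAt ℂ F z)
    (hlim : Tendsto ψ (comap Complex.re atTop) (𝓝 z)) :
    IsOpen (ψ '' rightHalfPlane L' ∪ {z}) := by
  have hsubL : rightHalfPlane L' ⊆ rightHalfPlane L := rightHalfPlane_subset hL'.le
  have hopen := hψ.isOpen_image hF (isOpen_rightHalfPlane L') hsubL
  obtain ⟨hFz, hFlim⟩ := eq_zero_and_tendsto_of_not_analyticAt (hF.normalForm z) hz
  obtain ⟨δ, hδ, hball⟩ := Metric.eventually_nhds_iff_ball.mp (eventually_nhdsWithin_iff.mp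
    ((tendsto_norm_cobounded_atTop.comp hFlim).eventually_gt_atTop (Real.exp L')))
  have hsub : ball z δ \ {z} ⊆ ψ '' rightHalfPlane L' := by
    refine subset_of_disjoint_frontier (isPreconnected_ball_diff_center z δ) hopen ?_ ?_
    · obtain ⟨ζ, hζδ, hζ⟩ := ((hlim.eventually (ball_mem_nhds z hδ)).and
        (eventually_mem_rightHalfPlane L')).exists
      refine ⟨ψ ζ, ⟨hζδ, fun hζz => ?_⟩, ζ, hζ, rfl⟩
      exact hψ.ne_zero (hsubL hζ) (hFz ▸ congrArg F hζz)
    · refine Set.disjoint_left.mpr fun y hy hfr => ?_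
      rcases hψ.eq_or_norm_eq_of_mem_frontier hF hL' hlim hfr with hyz | hline
      · exact hy.2 hyz
      · exact (hball y hy.1 hy.2).ne' hline
  rw [isOpen_iff_mem_nhds]
  rintro y (hy | rfl)
  · exact mem_of_superset (hopen.mem_nhds hy) subset_union_left
  · exact mem_of_superset (ball_mem_nhds y hδ)
      ((sdiff_subset_iff.mp hsub).trans_eq (union_comm _ _))

theorem image_subset_image_union_singleton {γ : ℝ → ℂ} (hL' : L < L') (hz : ¬ AnalyticAt ℂ F z)
    (hlim : Tendsto ψ (comap Complex.re atTop) (𝓝 z)) (hγ : ContinuousOn γ (Ici 0))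
    (hγF : ∀ t ∈ Ici (0 : ℝ), Real.exp L' < ‖F (γ t)‖ ∨ ¬ AnalyticAt ℂ F (γ t))
    (hγ0 : γ 0 ∈ ψ '' rightHalfPlane L') : γ '' Ici 0 ⊆ ψ '' rightHalfPlane L' ∪ {z} := by
  have hopen := hψ.isOpen_image_union_singleton hF hL' hz hlim
  refine subset_of_disjoint_frontier (isPreconnected_Ici.image _ hγ) hopen
    ⟨γ 0, ⟨0, self_mem_Ici, rfl⟩, Or.inl hγ0⟩ (Set.disjoint_left.mpr ?_)
  rintro _ ⟨t, ht, rfl⟩ hfr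
  rw [hopen.frontier_eq, closure_union, closure_singleton] at hfr
  have hne : γ t ≠ z := fun h => hfr.2 (Or.inr h)
  have hmem : γ t ∈ frontier (ψ '' rightHalfPlane L') := by
    rw [(hψ.isOpen_image hF (isOpen_rightHalfPlane L') (rightHalfPlane_subset hL'.le)).frontier_eq]
    exact ⟨hfr.1.resolve_right hne, fun h => hfr.2 (Or.inl h)⟩
  have hline := (hψ.eq_or_norm_eq_of_mem_frontier hF hL' hlim hmem).resolve_left hne
  refine (hγF t ht).elim (fun h => h.ne' hline) fun h => h (hF.analyticAt ?_)
  exact hline ▸ Real.exp_lt_exp.mpr hL'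

omit hF in
theorem isBounded_image {p : ℝ} (hp : 0 < p)
    (hper : ∀ x > L, Function.Periodic (fun y : ℝ => ψ (x + y * Complex.I)) p) (hL' : L < L')
    (hlim : Tendsto ψ (comap Complex.re atTop) (𝓝 z)) :
    Bornology.IsBounded (ψ '' rightHalfPlane L') := by
  obtain ⟨T, -, hT⟩ := (atTop_basis_Ioi.comap Complex.re).eventually_iff.mp
    (hlim.eventually (ball_mem_nhds z one_pos))
  refine ((hψ.isBounded_image_strip hp hper (b := T) hL').union
    (isBounded_ball (x := z) (r := 1))).subset ?_
  rintro _ ⟨ζ, hζ, rfl⟩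
  exact (le_or_gt ζ.re T).imp (fun h => ⟨ζ, ⟨le_of_lt hζ, h⟩, rfl⟩) fun h => hT h

-- A periodic branch maps a half plane onto a punctured neighbourhood of `∞` or of a pole of `F`.
-- The first is excluded by `hsmall`, the second by the curve `γ`, which is trapped in that
-- neighbourhood.
theorem injOn (hL' : L < L') (hsmall : ∀ K : ℝ, ∃ z, K < ‖z‖ ∧ ‖F z‖ ≤ Real.exp L)
    {γ : ℝ → ℂ} (hγ : ContinuousOn γ (Ici 0)) (hγlim : Tendsto γ atTop (cocompact ℂ))
    (hγF : ∀ t ∈ Ici (0 : ℝ), Real.exp L' < ‖F (γ t)‖ ∨ ¬ AnalyticAt ℂ F (γ t))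
    (hγ0 : γ 0 ∈ ψ '' rightHalfPlane L') : InjOn ψ (rightHalfPlane L) := by
  by_contra hinj
  obtain ⟨p, hp, hper⟩ := hψ.exists_period hF hinj
  rcases hψ.tendsto_cocompact_or hF with hlim | ⟨z, hz, hlim⟩
  · obtain ⟨K, hK⟩ := hψ.exists_lt_norm_subset_image hF hp hper hL' hlim
    obtain ⟨y, hyK, hyF⟩ := hsmall K
    obtain ⟨ζ, hζ, rfl⟩ := hK hyK
    exact (hψ.exp_lt_norm (rightHalfPlane_subset hL'.le hζ)).not_ge hyF
  · have hbounded : Bornology.IsBounded (γ '' Ici 0) :=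
      ((hψ.isBounded_image hp hper hL' hlim).union Bornology.isBounded_singleton).subset
        (hψ.image_subset_image_union_singleton hF hL' hz hlim hγ hγF hγ0)
    obtain ⟨t, ht, ht0⟩ := ((hγlim.eventually hbounded.isCompact_closure.compl_mem_cocompact).and
      (eventually_ge_atTop 0)).exists
    exact ht (subset_closure ⟨t, ht0, rfl⟩)

end IsLogInverse

/-! ### Harnack's inequality and the sub-mean value inequality -/

section Harnack

open InnerProductSpace

variable {u : ℂ → ℝ} {c w : ℂ} {R : ℝ}

theorem harmonicContOnCl_re {f : ℂ → ℂ} (hf : DiffContOnCl ℂ f (ball c R)) :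
    HarmonicContOnCl (fun z => (f z).re) (ball c R) :=
  ⟨fun _ hz => (hf.differentiableOn.analyticAt (isOpen_ball.mem_nhds hz)).harmonicAt_re,
    Complex.continuous_re.comp_continuousOn hf.continuousOn⟩

theorem nonneg_of_harmonicContOnCl (hu : HarmonicContOnCl u (ball c R))
    (hnonneg : ∀ z ∈ sphere c R, 0 ≤ u z) (hw : w ∈ ball c R) : 0 ≤ u w := by
  have hR : 0 < R := pos_of_mem_ball hw
  rw [← hu.circleAverage_re_herglotzRieszKernel_smul hw]
  refine Real.circleAverage_nonneg_of_nonneg fun z hz => ?_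
  rw [abs_of_pos hR] at hz
  refine mul_nonneg (le_trans ?_ (le_re_herglotzRieszKernel hz hw)) (hnonneg z hz)
  exact div_nonneg (sub_nonneg.mpr (mem_ball_iff_norm.mp hw).le) (by positivity)

theorem le_mul_circleAverage_of_harmonicContOnCl (hu : HarmonicContOnCl u (ball c R))
    (hnonneg : ∀ z ∈ sphere c R, 0 ≤ u z) (hw : w ∈ ball c R) :
    u w ≤ (R + ‖w - c‖) / (R - ‖w - c‖) * Real.circleAverage u c R := by
  have hR : 0 < R := pos_of_mem_ball hw
  have hcont : ContinuousOn u (sphere c |R|) := hu.continuousOn.mono <| by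
    rw [closure_ball c hR.ne', abs_of_pos hR]
    exact sphere_subset_closedBall
  conv_lhs => rw [← hu.circleAverage_re_herglotzRieszKernel_smul hw]
  rw [← smul_eq_mul, ← Real.circleAverage_smul]
  refine Real.circleAverage_mono ?_ (hcont.const_smul _).circleIntegrable' fun z hz => ?_
  · refine ((Complex.continuous_re.comp_continuousOn ?_).smul hcont).circleIntegrable'
    exact continuousOn_herglotzRieszKernel_sphere hw
  · rw [abs_of_pos hR] at hz
    exact mul_le_mul_of_nonneg_right (re_herglotzRieszKernel_le hz hw) (hnonneg z hz)

end Harnack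

theorem exists_polynomial_eq_of_mem_span_fourier {τ : C(UnitAddCircle, ℂ)}
    (hτ : τ ∈ Submodule.span ℂ (range (fourier (T := (1 : ℝ))))) : ∃ P Q : Polynomial ℂ,
      ∀ x : UnitAddCircle, τ x = P.eval (x.toCircle : ℂ) + conj (Q.eval (x.toCircle : ℂ)) := by
  induction hτ using Submodule.span_induction with
  | mem τ hτ =>
    obtain ⟨n, rfl⟩ := hτ
    rcases n with n | n
    · refine ⟨Polynomial.X ^ n, 0, fun x => ?_⟩
      rw [fourier_apply, AddCircle.toCircle_zsmul]
      simp
    · refine ⟨0, Polynomial.X ^ (n + 1), fun x => ?_⟩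
      rw [fourier_apply, AddCircle.toCircle_zsmul, zpow_negSucc]
      simp only [Polynomial.eval_zero, Polynomial.eval_pow, Polynomial.eval_X, zero_add,
        Circle.coe_inv, Circle.coe_pow, map_pow]
      rw [← Circle.coe_inv_eq_conj, Circle.coe_inv, inv_pow]
  | zero => exact ⟨0, 0, fun x => by simp⟩
  | add a b _ _ ha hb =>
    obtain ⟨P, Q, hPQ⟩ := ha
    obtain ⟨P', Q', hPQ'⟩ := hb
    refine ⟨P + P', Q + Q', fun x => ?_⟩
    simp only [ContinuousMap.add_apply, hPQ, hPQ', Polynomial.eval_add, map_add]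
    ring
  | smul k a _ ha =>
    obtain ⟨P, Q, hPQ⟩ := ha
    refine ⟨Polynomial.C k * P, Polynomial.C (conj k) * Q, fun x => ?_⟩
    simp only [ContinuousMap.smul_apply, hPQ, Polynomial.eval_mul, Polynomial.eval_C, map_mul,
      Complex.conj_conj, smul_eq_mul]
    ring

theorem exists_polynomial_re_approx_circle {v : Circle → ℝ} (hv : Continuous v) {δ : ℝ}
    (hδ : 0 < δ) : ∃ p : Polynomial ℂ, ∀ z : Circle, |v z - (p.eval (z : ℂ)).re| < δ := by
  let w : C(UnitAddCircle, ℂ) := ⟨fun x => (v x.toCircle : ℂ),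
    Complex.continuous_ofReal.comp (hv.comp AddCircle.continuous_toCircle)⟩
  have hdense : w ∈ (Submodule.span ℂ (range (fourier (T := (1 : ℝ))))).topologicalClosure := by
    rw [span_fourier_closure_eq_top]
    exact Submodule.mem_top
  obtain ⟨τ, hτ, hdist⟩ := Metric.mem_closure_iff.mp hdense δ hδ
  obtain ⟨P, Q, hPQ⟩ := exists_polynomial_eq_of_mem_span_fourier hτ
  refine ⟨P + Q, fun z => ?_⟩
  obtain ⟨x, rfl⟩ := (AddCircle.homeomorphCircle (one_ne_zero (α := ℝ))).surjective z
  have hnorm := (ContinuousMap.dist_apply_le_dist x).trans_lt hdist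
  rw [hPQ x, dist_eq_norm] at hnorm
  simpa [w, AddCircle.homeomorphCircle_apply] using (Complex.abs_re_le_norm _).trans_lt hnorm

theorem exists_polynomial_re_approx {u : ℂ → ℝ} {c : ℂ} {R : ℝ} (hR : 0 < R)
    (hu : ContinuousOn u (sphere c R)) {δ : ℝ} (hδ : 0 < δ) :
    ∃ p : Polynomial ℂ, ∀ z ∈ sphere c R, |u z - (p.eval z).re| < δ := by
  have hmem : ∀ z : Circle, c + R * (z : ℂ) ∈ sphere c R := fun z => by
    rw [mem_sphere_iff_norm, add_sub_cancel_left, norm_mul, Complex.norm_real,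
      Real.norm_of_nonneg hR.le, Circle.norm_coe z, mul_one]
  obtain ⟨p, hp⟩ := exists_polynomial_re_approx_circle (hu.comp_continuous (by fun_prop) hmem) hδ
  refine ⟨p.comp (Polynomial.C (R : ℂ)⁻¹ * (Polynomial.X - Polynomial.C c)), fun z hz => ?_⟩
  have hR0 : (R : ℂ) ≠ 0 := by exact_mod_cast hR.ne'
  have hunit : ‖(R : ℂ)⁻¹ * (z - c)‖ = 1 := by
    rw [norm_mul, mem_sphere_iff_norm.mp hz, norm_inv, Complex.norm_real, Real.norm_of_nonneg hR.le,
      inv_mul_cancel₀ hR.ne']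
  simpa [Function.comp_def, Polynomial.eval_comp, mul_inv_cancel_left₀ hR0] using
    hp ⟨(R : ℂ)⁻¹ * (z - c), mem_sphere_zero_iff_norm.mpr hunit⟩

section SubMeanValue

variable {u : ℂ → ℝ} {G : ℂ → ℂ} {V : Set ℂ} {c w : ℂ} {R : ℝ} (hV : IsOpen V)
  (hG : DiffContOnCl ℂ G V) (huG : ∀ z ∈ closure V, ‖G z‖ = Real.exp (u z))
  (hu0 : ∀ z ∉ V, u z = 0) (hnonneg : ∀ z ∈ sphere c R, 0 ≤ u z) (hw : w ∈ ball c R)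
include hV hG huG hu0 hnonneg hw

-- The maximum principle for `G * exp (-f)` on `V ∩ ball c R`.
theorem le_re_of_forall_mem_sphere_le_re {f : ℂ → ℂ} (hf : DiffContOnCl ℂ f (ball c R))
    (hle : ∀ z ∈ sphere c R, u z ≤ (f z).re) : u w ≤ (f w).re := by
  have hfnonneg : ∀ z ∈ ball c R, 0 ≤ (f z).re := fun z hz =>
    nonneg_of_harmonicContOnCl (u := fun z => (f z).re) (harmonicContOnCl_re hf)
      (fun y hy => (hnonneg y hy).trans (hle y hy)) hz
  by_cases hwV : w ∉ V
  · exact (hu0 w hwV).trans_le (hfnonneg w hw)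
  have hnorm : ∀ z ∈ closure V, ‖G z * Complex.exp (-f z)‖ = Real.exp (u z - (f z).re) :=
    fun z hz => by
      rw [norm_mul, huG z hz, Complex.norm_exp, ← Real.exp_add, Complex.neg_re, sub_eq_add_neg]
  have hdiff : DiffContOnCl ℂ (fun z => G z * Complex.exp (-f z)) (V ∩ ball c R) :=
    (hG.mono inter_subset_left).smul
      (Complex.differentiable_exp.comp_diffContOnCl (hf.mono inter_subset_right).neg)
  have hmax := Complex.norm_le_of_forall_mem_frontier_norm_le (C := 1)
    (isBounded_ball.subset inter_subset_right) hdiff (fun z hz => ?_)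
    (subset_closure ⟨not_not.mp hwV, hw⟩)
  · rwa [hnorm w (subset_closure (not_not.mp hwV)), Real.exp_le_one_iff, sub_nonpos] at hmax
  rw [(hV.inter isOpen_ball).frontier_eq] at hz
  rw [hnorm z (closure_mono inter_subset_left hz.1), Real.exp_le_one_iff, sub_nonpos]
  have hzR : dist z c ≤ R := closure_ball_subset_closedBall (closure_mono inter_subset_right hz.1)
  rcases hzR.lt_or_eq with hball | hsphere
  · exact (hu0 z fun hzV => hz.2 ⟨hzV, hball⟩).trans_le (hfnonneg z hball)
  · exact hle z hsphere

-- The Poisson integral of `u` dominates `u`; it is replaced by a polynomial approximating it.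
theorem le_mul_circleAverage_of_norm_eq_exp (hu : ContinuousOn u (sphere c R)) :
    u w ≤ (R + ‖w - c‖) / (R - ‖w - c‖) * Real.circleAverage u c R := by
  have hR : 0 < R := pos_of_mem_ball hw
  have hK : 0 < (R + ‖w - c‖) / (R - ‖w - c‖) :=
    div_pos (by positivity) (sub_pos.mpr (mem_ball_iff_norm.mp hw))
  set K : ℝ := (R + ‖w - c‖) / (R - ‖w - c‖)
  refine le_of_forall_pos_le_add fun ε hε => ?_
  obtain ⟨p, hp⟩ := exists_polynomial_re_approx hR (hu.add continuousOn_const)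
    (δ := ε / K / 2) (u := fun z => u z + ε / K / 2) (by positivity)
  have hdiff : DiffContOnCl ℂ (fun z => p.eval z) (ball c R) := p.differentiable.diffContOnCl
  have hlower : ∀ z ∈ sphere c R, u z ≤ (p.eval z).re := fun z hz => by
    linarith [(abs_lt.mp (hp z hz)).2]
  have hupper : ∀ z ∈ sphere c R, (p.eval z).re ≤ u z + ε / K := fun z hz => by
    linarith [(abs_lt.mp (hp z hz)).1]
  have havg : Real.circleAverage (fun z => (p.eval z).re) c R ≤
      Real.circleAverage u c R + ε / K := by
    rw [← Real.circleAverage_const (ε / K) c R, ← Real.circleAverage_fun_add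
      (hu.circleIntegrable hR.le) (continuousOn_const.circleIntegrable hR.le)]
    exact Real.circleAverage_mono
      ((Complex.continuous_re.comp p.continuous).continuousOn.circleIntegrable hR.le)
      ((hu.add continuousOn_const).circleIntegrable hR.le)
      fun z hz => hupper z (abs_of_pos hR ▸ hz)
  calc u w ≤ (p.eval w).re :=
        le_re_of_forall_mem_sphere_le_re hV hG huG hu0 hnonneg hw hdiff hlower
    _ ≤ K * Real.circleAverage (fun z => (p.eval z).re) c R :=
        le_mul_circleAverage_of_harmonicContOnCl (harmonicContOnCl_re hdiff)
          (fun z hz => (hnonneg z hz).trans (hlower z hz)) hw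
    _ ≤ K * (Real.circleAverage u c R + ε / K) := by gcongr
    _ = K * Real.circleAverage u c R + ε := by rw [mul_add, mul_div_cancel₀ _ hK.ne']

end SubMeanValue

/-- The function `log |F| - L'` on the tract `ψ (re > L')`, extended by zero: a continuous
subharmonic function on the plane. -/
noncomputable def tractLog (F ψ : ℂ → ℂ) (L' : ℝ) : ℂ → ℝ :=
  (ψ '' rightHalfPlane L').indicator fun z => Real.log ‖F z‖ - L'

namespace IsLogInverse

variable {F ψ : ℂ → ℂ} {L L' : ℝ} (hψ : IsLogInverse F L ψ) (hF : UnramifiedAbove F L)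
  (hL' : L < L')
include hψ hL'

theorem tractLog_apply {ζ : ℂ} (hζ : L' ≤ ζ.re) : tractLog F ψ L' (ψ ζ) = ζ.re - L' := by
  have hlog : Real.log ‖F (ψ ζ)‖ = ζ.re := by
    rw [hψ.norm_eq (show L < ζ.re from hL'.trans_le hζ), Real.log_exp]
  by_cases hmem : ψ ζ ∈ ψ '' rightHalfPlane L'
  · rw [tractLog, indicator_of_mem hmem, hlog]
  · have hline : ζ.re = L' := (hζ.eq_of_not_lt fun hlt => hmem ⟨ζ, hlt, rfl⟩).symm
    rw [tractLog, indicator_of_notMem hmem, hline, sub_self]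

theorem tractLog_nonneg (z : ℂ) : 0 ≤ tractLog F ψ L' z := by
  by_cases hz : z ∈ ψ '' rightHalfPlane L'
  · obtain ⟨ζ, hζ, rfl⟩ := hz
    have hζ' : L' < ζ.re := hζ
    rw [hψ.tractLog_apply hL' hζ'.le]
    exact sub_nonneg.mpr hζ'.le
  · rw [tractLog, indicator_of_notMem hz]

include hF

variable (hlim : Tendsto ψ (comap Complex.re atTop) (cocompact ℂ))
include hlim

theorem exists_eq_of_mem_frontier {z : ℂ} (hz : z ∈ frontier (ψ '' rightHalfPlane L')) :
    ∃ ζ, ζ.re = L' ∧ ψ ζ = z :=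
  (hψ.frontier_image_subset hF hL' hz).resolve_right fun h =>
    not_mapClusterPt_of_tendsto_cocompact hlim z h.2

theorem closure_image_subset : closure (ψ '' rightHalfPlane L') ⊆ ψ '' {ζ | L' ≤ ζ.re} := by
  rw [closure_eq_self_union_frontier]
  rintro z (⟨ζ, hζ, rfl⟩ | hz)
  · exact ⟨ζ, le_of_lt (show L' < ζ.re from hζ), rfl⟩
  · obtain ⟨ζ, hζ, rfl⟩ := hψ.exists_eq_of_mem_frontier hF hL' hlim hz
    exact ⟨ζ, hζ.ge, rfl⟩

theorem differentiableAt_of_mem_closure {z : ℂ} (hz : z ∈ closure (ψ '' rightHalfPlane L')) :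
    DifferentiableAt ℂ F z := by
  obtain ⟨ζ, hζ, rfl⟩ := hψ.closure_image_subset hF hL' hlim hz
  exact (hF.analyticAt (hψ.exp_lt_norm (show L < ζ.re from hL'.trans_le hζ))).differentiableAt

theorem continuous_tractLog : Continuous (tractLog F ψ L') := by
  refine continuous_indicator (fun z hz => ?_) fun z hz => ?_
  · obtain ⟨ζ, hζ, rfl⟩ := hψ.exists_eq_of_mem_frontier hF hL' hlim hz
    rw [hψ.norm_eq (show L < ζ.re from hL'.trans_eq hζ.symm), Real.log_exp, hζ, sub_self]
  · have hdiff := hψ.differentiableAt_of_mem_closure hF hL' hlim hz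
    obtain ⟨ζ, hζ, rfl⟩ := hψ.closure_image_subset hF hL' hlim hz
    have hne : F (ψ ζ) ≠ 0 := hψ.ne_zero (show L < ζ.re from hL'.trans_le hζ)
    exact ((hdiff.continuousAt.norm.log (norm_ne_zero_iff.mpr hne)).sub
      continuousAt_const).continuousWithinAt

theorem re_sub_le_three_mul_circleAverage {R : ℝ} (hR : 0 < R) {ζ : ℂ}
    (hζ : ζ ∈ rightHalfPlane L') (hζR : ‖ψ ζ‖ ≤ R / 2) :
    ζ.re - L' ≤ 3 * Real.circleAverage (tractLog F ψ L') 0 R := by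
  have hζ' : L' < ζ.re := hζ
  have hG : DiffContOnCl ℂ (fun z => F z * Complex.exp (-L')) (ψ '' rightHalfPlane L') :=
    DifferentiableOn.diffContOnCl fun z hz =>
      ((hψ.differentiableAt_of_mem_closure hF hL' hlim hz).mul_const _).differentiableWithinAt
  have hnorm : ∀ z ∈ closure (ψ '' rightHalfPlane L'),
      ‖F z * Complex.exp (-L')‖ = Real.exp (tractLog F ψ L' z) := fun z hz => by
    obtain ⟨ξ, hξ, rfl⟩ := hψ.closure_image_subset hF hL' hlim hz
    rw [hψ.tractLog_apply hL' hξ, norm_mul, hψ.norm_eq (show L < ξ.re from hL'.trans_le hξ),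
      Complex.norm_exp, ← Real.exp_add, ← Complex.ofReal_neg, Complex.ofReal_re, sub_eq_add_neg]
  have hHarnack := le_mul_circleAverage_of_norm_eq_exp (c := 0) (R := R) (w := ψ ζ)
    (hψ.isOpen_image hF (isOpen_rightHalfPlane L') (rightHalfPlane_subset hL'.le)) hG hnorm
    (fun z hz => indicator_of_notMem hz _) (fun z _ => hψ.tractLog_nonneg hL' z)
    (by rw [mem_ball_zero_iff]; linarith) (hψ.continuous_tractLog hF hL' hlim).continuousOn
  rw [hψ.tractLog_apply hL' hζ'.le, sub_zero] at hHarnack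
  refine hHarnack.trans (mul_le_mul_of_nonneg_right ?_
    (Real.circleAverage_nonneg_of_nonneg fun z _ => hψ.tractLog_nonneg hL' z))
  rw [div_le_iff₀ (by linarith)]
  linarith

end IsLogInverse

/-! ### The square root bound -/

theorem one_sub_ne_zero {w : ℂ} (hw : w ∈ ball 0 1) : 1 - w ≠ 0 := by
  rw [mem_ball_zero_iff] at hw
  refine sub_ne_zero.mpr ?_
  rintro rfl
  exact hw.ne norm_one

theorem re_cayley_pos {w : ℂ} (hw : w ∈ ball 0 1) : 0 < ((1 + w) / (1 - w)).re := by
  have hbound := le_re_herglotzRieszKernel (c := 0) (R := 1) (z := 1) (by simp) hw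
  simp only [sub_zero] at hbound
  rw [mem_ball_zero_iff] at hw
  exact (div_pos (sub_pos.mpr hw) (by positivity)).trans_le hbound

theorem norm_le_of_injOn_rightHalfPlane {f : ℂ → ℂ} {a d : ℝ}
    (hf : DifferentiableOn ℂ f (rightHalfPlane a)) (hinj : InjOn f (rightHalfPlane a)) (hd : 0 < d)
    (hfd : ∀ ζ ∈ rightHalfPlane a, d < ‖f ζ‖) {x : ℝ} (hx : 1 ≤ x) :
    ‖f (a + x)‖ ≤ 8 * ‖f (a + 1)‖ ^ 2 / d * (1 + x) ^ 2 := by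
  let cayley : ℂ → ℂ := fun w => a + (1 + w) / (1 - w)
  have hmaps : MapsTo cayley (ball 0 1) (rightHalfPlane a) := fun w hw => by
    simpa [cayley, rightHalfPlane] using re_cayley_pos hw
  have hdiff : DifferentiableOn ℂ cayley (ball 0 1) := fun w hw =>
    ((DifferentiableAt.div (by fun_prop) (by fun_prop) (one_sub_ne_zero hw)).const_add
      (a : ℂ)).differentiableWithinAt
  have hcayley_inj : InjOn cayley (ball 0 1) := fun w hw v hv h => by
    have heq : (1 + w) / (1 - w) = (1 + v) / (1 - v) := add_left_cancel h
    rw [div_eq_div_iff (one_sub_ne_zero hw) (one_sub_ne_zero hv)] at heq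
    linear_combination heq / 2
  set t : ℝ := (x - 1) / (x + 1)
  have ht : ‖(t : ℂ)‖ = t := by
    rw [Complex.norm_real, Real.norm_of_nonneg (div_nonneg (by linarith) (by linarith))]
  have ht1 : t < 1 := (div_lt_one (by linarith)).mpr (by linarith)
  have hcayley_t : cayley t = a + x := by
    have hreal : (1 + t) / (1 - t) = x := by
      simp only [t]
      field_simp
      ring
    simp only [cayley, ← hreal]
    push_cast
    rfl
  have hgrowth := norm_le_of_injOn_ball (hf.comp hdiff hmaps) (hinj.comp hcayley_inj hmaps) hd
    (fun w hw => hfd _ (hmaps hw)) (ht.trans_lt ht1)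
  have hcayley_zero : cayley 0 = a + 1 := by simp [cayley]
  rw [Function.comp_apply, Function.comp_apply, hcayley_t, hcayley_zero, ht] at hgrowth
  refine hgrowth.trans_eq ?_
  simp only [t]
  field_simp
  ring

namespace IsLogInverse

variable {F ψ : ℂ → ℂ} {L L' : ℝ} (hψ : IsLogInverse F L ψ) (hF : UnramifiedAbove F L)
  (hL' : L < L')
include hψ hF hL'

theorem exists_forall_lt_norm_sub (hinj : InjOn ψ (rightHalfPlane L)) :
    ∃ p, ∃ ε > 0, ∀ ζ ∈ rightHalfPlane L', ε < ‖ψ ζ - p‖ := by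
  have hopen : IsOpen (rightHalfPlane L ∩ {ζ : ℂ | ζ.re < L'}) :=
    (isOpen_rightHalfPlane L).inter (isOpen_lt Complex.continuous_re continuous_const)
  obtain ⟨a, haL, haL'⟩ := exists_between hL'
  obtain ⟨ε, hε, hball⟩ := nhds_basis_closedBall.mem_iff.mp
    ((hψ.isOpen_image hF hopen inter_subset_left).mem_nhds
      ⟨(a : ℂ), by simpa [rightHalfPlane] using ⟨haL, haL'⟩, rfl⟩)
  refine ⟨ψ a, ε, hε, fun ζ hζ => not_le.mp fun h => ?_⟩
  obtain ⟨ξ, ⟨hξL, hξL'⟩, hξζ⟩ := hball (mem_closedBall_iff_norm.mpr h)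
  have heq : ξ = ζ := hinj hξL (rightHalfPlane_subset hL'.le hζ) hξζ
  subst heq
  exact lt_asymm (show ξ.re < L' from hξL') hζ

theorem exists_norm_le_sq (hinj : InjOn ψ (rightHalfPlane L)) :
    ∃ C > 0, ∀ x : ℝ, 1 ≤ x → ‖ψ (L' + x)‖ ≤ C * (1 + x) ^ 2 := by
  obtain ⟨p, ε, hε, hfar⟩ := hψ.exists_forall_lt_norm_sub hF hL' hinj
  have hsub := rightHalfPlane_subset hL'.le
  have hgrowth := fun (x : ℝ) (hx : 1 ≤ x) => norm_le_of_injOn_rightHalfPlane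
    (((hψ.differentiableOn hF).mono hsub).sub_const p)
    (fun ζ hζ ω hω h => hinj (hsub hζ) (hsub hω) (sub_left_injective h)) hε hfar hx
  set A : ℝ := 8 * ‖ψ (L' + 1) - p‖ ^ 2 / ε
  have : 0 ≤ A := by positivity
  refine ⟨A + ‖p‖ + 1, by positivity, fun x hx => ?_⟩
  have hone : 1 ≤ (1 + x) ^ 2 := one_le_pow₀ (by linarith)
  calc ‖ψ (L' + x)‖ ≤ ‖ψ (L' + x) - p‖ + ‖p‖ := by simpa using norm_add_le (ψ (L' + x) - p) p
    _ ≤ A * (1 + x) ^ 2 + (‖p‖ + 1) * (1 + x) ^ 2 :=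
        add_le_add (hgrowth x hx) ((le_add_of_nonneg_right zero_le_one).trans
          (le_mul_of_one_le_right (by positivity) hone))
    _ = (A + ‖p‖ + 1) * (1 + x) ^ 2 := by ring

variable (hlim : Tendsto ψ (comap Complex.re atTop) (cocompact ℂ))
include hlim

theorem circleAverage_tractLog_le_proximity (hL'0 : 0 ≤ L') {r : ℝ} (hr : 0 ≤ r) :
    Real.circleAverage (tractLog F ψ L') 0 r ≤ ValueDistribution.proximity F ⊤ r := by
  have hmer : Meromorphic F := fun z => (hF.normalForm z).meromorphicAt
  rw [ValueDistribution.proximity_top]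
  refine Real.circleAverage_mono
    ((hψ.continuous_tractLog hF hL' hlim).continuousOn.circleIntegrable hr)
    hmer.meromorphicOn.circleIntegrable_posLog_norm fun z _ => ?_
  exact indicator_le' (g := fun w => Real.posLog ‖F w‖)
    (fun w _ => (sub_le_self _ hL'0).trans (le_max_right _ _)) (fun w _ => Real.posLog_nonneg) z

omit hF in
theorem eventually_exists_norm_eq :
    ∀ᶠ r in atTop, ∃ x : ℝ, 1 ≤ x ∧ ‖ψ (L' + x)‖ = r := by
  have hmem : MapsTo (fun x : ℝ => (L' + x : ℂ)) (Ici 1) (rightHalfPlane L) := fun x hx => by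
    have hx1 : 1 ≤ x := hx
    simp only [rightHalfPlane, mem_ofPred_eq, Complex.add_re, Complex.ofReal_re]
    linarith
  have hcont : ContinuousOn (fun x : ℝ => ‖ψ (L' + x)‖) (Ici 1) :=
    (hψ.continuousOn.comp (by fun_prop) hmem).norm
  have htop : Tendsto (fun x : ℝ => ‖ψ (L' + x)‖) atTop atTop := by
    refine (tendsto_norm_cocompact_atTop.comp hlim).comp (tendsto_comap_iff.mpr ?_)
    simpa [Function.comp_def] using tendsto_atTop_add_const_left atTop L' tendsto_id
  filter_upwards [eventually_ge_atTop ‖ψ (L' + (1 : ℝ))‖] with r hr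
  obtain ⟨b, hb1, hb⟩ := ((eventually_ge_atTop 1).and (htop.eventually_ge_atTop r)).exists
  obtain ⟨x, hx, hxr⟩ := intermediate_value_Icc hb1 (hcont.mono Icc_subset_Ici_self) ⟨hr, hb⟩
  exact ⟨x, hx.1, hxr⟩

omit hL' hlim in
theorem exists_mul_sqrt_le_proximity (hinj : InjOn ψ (rightHalfPlane L)) (hL : 0 ≤ L) :
    ∃ c > 0, ∀ᶠ r in atTop, c * √r ≤ ValueDistribution.proximity F ⊤ r := by
  have hL' : L < L + 1 := lt_add_one L
  have hlim := hψ.tendsto_cocompact_of_injOn hF hinj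
  obtain ⟨C, hC, hgrowth⟩ := hψ.exists_norm_le_sq hF hL' hinj
  refine ⟨1 / (6 * √(2 * C)), by positivity, ?_⟩
  filter_upwards [(tendsto_id.atTop_div_const two_pos).eventually
    (hψ.eventually_exists_norm_eq hL' hlim), eventually_ge_atTop (8 * C),
    eventually_gt_atTop 0] with r ⟨x, hx, hxr⟩ hrC hr
  have hmem : (((L + 1 : ℝ) : ℂ) + x) ∈ rightHalfPlane (L + 1) := by
    simpa [rightHalfPlane] using one_pos.trans_le hx
  have hproximity : x ≤ 3 * ValueDistribution.proximity F ⊤ r := by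
    have hHarnack := hψ.re_sub_le_three_mul_circleAverage hF hL' hlim hr hmem hxr.le
    rw [Complex.add_re, Complex.ofReal_re, Complex.ofReal_re, add_sub_cancel_left] at hHarnack
    linarith [hψ.circleAverage_tractLog_le_proximity hF hL' hlim (by linarith) hr.le]
  have hsqrt : √r ≤ √(2 * C) * (1 + x) := by
    rw [← Real.sqrt_sq (show 0 ≤ 1 + x by linarith), ← Real.sqrt_mul (by positivity)]
    refine Real.sqrt_le_sqrt ?_
    have hbound := hxr ▸ hgrowth x hx
    simp only [id] at hbound
    linarith
  have hlarge : 2 * √(2 * C) ≤ √r := Real.le_sqrt_of_sq_le <| by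
    rw [mul_pow, Real.sq_sqrt (by positivity)]
    linarith
  have hpos : 0 < √(2 * C) := by positivity
  rw [div_mul_eq_mul_div, one_mul, div_le_iff₀ (by positivity)]
  nlinarith

end IsLogInverse

/-! ### Rationality criterion -/

theorem exists_norm_dslope_le {E : ℂ → ℂ} (hE : Differentiable ℂ E) {C : ℝ} {N : ℕ}
    (hgrowth : ∀ z, ‖E z‖ ≤ C * (1 + ‖z‖) ^ (N + 1)) :
    ∃ C', ∀ z, ‖dslope E 0 z‖ ≤ C' * (1 + ‖z‖) ^ N := by
  have hdslope : Differentiable ℂ (dslope E 0) := by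
    rw [← differentiableOn_univ, Complex.differentiableOn_dslope univ_mem]
    exact hE.differentiableOn
  obtain ⟨M, hM⟩ := (isCompact_closedBall (0 : ℂ) 1).exists_bound_of_continuousOn
    hdslope.continuous.continuousOn
  have hM0 : 0 ≤ M := (norm_nonneg _).trans (hM 0 (by simp))
  have hE0 : ‖E 0‖ ≤ C := by simpa using hgrowth 0
  have hC : 0 ≤ C := (norm_nonneg _).trans hE0
  refine ⟨3 * C + M, fun z => ?_⟩
  have hpow : 1 ≤ (1 + ‖z‖) ^ N := one_le_pow₀ (by linarith [norm_nonneg z])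
  rcases le_or_gt ‖z‖ 1 with hz | hz
  · calc ‖dslope E 0 z‖ ≤ M := hM z (mem_closedBall_zero_iff.mpr hz)
      _ ≤ 3 * C + M := by linarith
      _ ≤ (3 * C + M) * (1 + ‖z‖) ^ N := le_mul_of_one_le_right (by positivity) hpow
  · have hz0 : 0 < ‖z‖ := one_pos.trans hz
    rw [dslope_of_ne _ (norm_pos_iff.mp hz0), slope_def_field, norm_div, sub_zero,
      div_le_iff₀ hz0]
    calc ‖E z - E 0‖ ≤ C * (1 + ‖z‖) ^ (N + 1) + C :=
          (norm_sub_le _ _).trans (add_le_add (hgrowth z) hE0)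
      _ ≤ C * ((1 + ‖z‖) ^ N * (2 * ‖z‖)) + C * ((1 + ‖z‖) ^ N * ‖z‖) := by
          rw [pow_succ]
          gcongr
          · linarith
          · exact le_mul_of_one_le_right hC (one_le_mul_of_one_le_of_one_le hpow hz.le)
      _ = 3 * C * (1 + ‖z‖) ^ N * ‖z‖ := by ring
      _ ≤ (3 * C + M) * (1 + ‖z‖) ^ N * ‖z‖ := by
          gcongr
          exact le_add_of_nonneg_right hM0

theorem exists_polynomial_of_norm_le {E : ℂ → ℂ} (hE : Differentiable ℂ E) {C : ℝ} {N : ℕ}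
    (hgrowth : ∀ z, ‖E z‖ ≤ C * (1 + ‖z‖) ^ N) : ∃ P : Polynomial ℂ, ∀ z, E z = P.eval z := by
  induction N generalizing E C with
  | zero =>
    have hbounded : Bornology.IsBounded (range E) :=
      isBounded_iff_forall_norm_le.mpr ⟨C, forall_mem_range.mpr fun z => by simpa using hgrowth z⟩
    exact ⟨Polynomial.C (E 0), fun z => by
      rw [Polynomial.eval_C, hE.apply_eq_apply_of_bounded hbounded z 0]⟩
  | succ N ih =>
    have hdslope : Differentiable ℂ (dslope E 0) := by
      rw [← differentiableOn_univ, Complex.differentiableOn_dslope univ_mem]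
      exact hE.differentiableOn
    obtain ⟨C', hC'⟩ := exists_norm_dslope_le hE hgrowth
    obtain ⟨P, hP⟩ := ih hdslope hC'
    refine ⟨Polynomial.C (E 0) + Polynomial.X * P, fun z => ?_⟩
    have hdecomp := sub_smul_dslope E 0 z
    rw [sub_zero, smul_eq_mul, hP] at hdecomp
    simp [hdecomp]

theorem eventually_nhdsNE_of_codiscrete {P : ℂ → Prop} (h : ∀ᶠ z in codiscrete ℂ, P z) (z : ℂ) :
    ∀ᶠ y in 𝓝[≠] z, P y := by
  have hdisj := mem_codiscrete.mp h z
  rwa [disjoint_principal_right, compl_compl] at hdisj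

theorem exists_prod_zpow_eq_div (s : Finset ℂ) (d : ℂ → ℤ) : ∃ p q : Polynomial ℂ, q ≠ 0 ∧
    ∀ z, ∏ u ∈ s, (z - u) ^ d u = p.eval z / q.eval z := by
  have hfactor : ∀ u : ℂ, ∃ p q : Polynomial ℂ, q ≠ 0 ∧
      ∀ z, (z - u) ^ d u = p.eval z / q.eval z := by
    intro u
    rcases (d u).eq_nat_or_neg with ⟨n, hn | hn⟩
    · exact ⟨(Polynomial.X - Polynomial.C u) ^ n, 1, one_ne_zero, fun z => by simp [hn]⟩
    · exact ⟨1, (Polynomial.X - Polynomial.C u) ^ n,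
        pow_ne_zero _ (Polynomial.X_sub_C_ne_zero u), fun z => by simp [hn]⟩
  choose p q hq hpq using hfactor
  refine ⟨∏ u ∈ s, p u, ∏ u ∈ s, q u, Finset.prod_ne_zero_iff.mpr fun u _ => hq u, fun z => ?_⟩
  rw [Polynomial.eval_prod, Polynomial.eval_prod, ← Finset.prod_div_distrib]
  exact Finset.prod_congr rfl fun u _ => hpq u z

theorem exists_norm_prod_zpow_le (s : Finset ℂ) (d : ℂ → ℤ) : ∃ C ≥ 0, ∃ N : ℕ, ∀ z : ℂ,
    (∀ u ∈ s, 1 ≤ ‖z - u‖) → ‖∏ u ∈ s, (z - u) ^ d u‖ ≤ C * (1 + ‖z‖) ^ N := by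
  refine ⟨∏ u ∈ s, (1 + ‖u‖) ^ (d u).natAbs, Finset.prod_nonneg fun u _ => by positivity,
    ∑ u ∈ s, (d u).natAbs, fun z hz => ?_⟩
  rw [norm_prod, ← Finset.prod_pow_eq_pow_sum, ← Finset.prod_mul_distrib]
  refine Finset.prod_le_prod (fun u _ => norm_nonneg _) fun u hu => ?_
  rw [norm_zpow, ← mul_pow]
  calc ‖z - u‖ ^ d u ≤ ‖z - u‖ ^ ((d u).natAbs : ℤ) :=
        zpow_le_zpow_right₀ (hz u hu) Int.le_natAbs
    _ = ‖z - u‖ ^ (d u).natAbs := zpow_natCast _ _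
    _ ≤ ((1 + ‖u‖) * (1 + ‖z‖)) ^ (d u).natAbs := by
        refine pow_le_pow_left₀ (norm_nonneg _) ?_ _
        nlinarith [norm_sub_le z u, norm_nonneg z, norm_nonneg u]

theorem norm_le_of_eventually_codiscrete {G : ℂ → ℂ} (hG : Continuous G) {B : ℂ → ℝ}
    (hB : Continuous B) {U : Set ℂ} (hU : IsOpen U)
    (h : ∀ᶠ z in codiscrete ℂ, z ∈ U → ‖G z‖ ≤ B z) {z : ℂ} (hz : z ∈ U) : ‖G z‖ ≤ B z := by
  refine le_of_tendsto_of_tendsto (b := 𝓝[≠] z) (hG.norm.continuousAt.mono_left nhdsWithin_le_nhds)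
    (hB.continuousAt.mono_left nhdsWithin_le_nhds) ?_
  filter_upwards [eventually_nhdsNE_of_codiscrete h z,
    nhdsWithin_le_nhds (hU.mem_nhds hz)] with y hy hyU
  exact hy hyU

theorem exists_eventually_eq_prod_zpow_mul {F : ℂ → ℂ} (hF : Meromorphic F) {K : ℝ}
    (hK : ∀ z, K < ‖z‖ → meromorphicOrderAt F z = 0) :
    ∃ (s : Finset ℂ) (d : ℂ → ℤ) (g : ℂ → ℂ), (∀ u ∈ s, ‖u‖ ≤ K) ∧ Differentiable ℂ g ∧
      (∀ z, g z ≠ 0) ∧ ∀ᶠ z in codiscrete ℂ, F z = (∏ u ∈ s, (z - u) ^ d u) * g z := by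
  have hF' : MeromorphicOn F univ := hF.meromorphicOn
  have horder : ∀ u : (univ : Set ℂ), meromorphicOrderAt F u ≠ ⊤ := by
    rw [← hF'.exists_meromorphicOrderAt_ne_top_iff_forall isConnected_univ]
    obtain ⟨z, hz⟩ := NormedField.exists_lt_norm ℂ K
    exact ⟨⟨z, mem_univ z⟩, by simp [hK z hz]⟩
  set D := MeromorphicOn.divisor F univ
  have hsupport : ∀ z ∈ D.support, ‖z‖ ≤ K := fun z hz => not_lt.mp fun hKz =>
    hz (by simp [D, MeromorphicOn.divisor_apply hF' (mem_univ z), hK z hKz])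
  have hfinite : D.support.Finite := by
    refine ((MeromorphicOn.divisor F (closedBall 0 K)).finiteSupport
      (isCompact_closedBall 0 K)).subset fun z hz => ?_
    have hzK : z ∈ closedBall (0 : ℂ) K := mem_closedBall_zero_iff.mpr (hsupport z hz)
    rw [Function.mem_support, MeromorphicOn.divisor_apply hF' (mem_univ z)] at hz
    rwa [Function.mem_support, MeromorphicOn.divisor_apply hF.meromorphicOn hzK]
  obtain ⟨g, hg, hg0, hFg⟩ := hF'.extract_zeros_poles horder hfinite
  refine ⟨hfinite.toFinset, D, g, fun u hu => hsupport u (hfinite.mem_toFinset.mp hu),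
    fun z => (hg z (mem_univ z)).differentiableAt, fun z => hg0 ⟨z, mem_univ z⟩, ?_⟩
  filter_upwards [hFg] with z hz
  rw [hz, Pi.smul_apply', smul_eq_mul, Function.FactorizedRational.finprod_eq_fun hfinite]
  refine congrArg (· * g z) (finprod_eq_prod_of_mulSupport_subset _ fun u hu => ?_)
  rw [hfinite.coe_toFinset]
  exact fun hDu => hu (by simp [show D u = 0 from hDu])

theorem exists_norm_inv_le_of_lt_norm_mul {F g : ℂ → ℂ} {s : Finset ℂ} {d : ℂ → ℤ} {m K : ℝ}
    (hm : 0 < m) (hs : ∀ u ∈ s, ‖u‖ ≤ K) (hg : Differentiable ℂ g) (hg0 : ∀ z, g z ≠ 0)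
    (hFg : ∀ᶠ z in codiscrete ℂ, F z = (∏ u ∈ s, (z - u) ^ d u) * g z)
    (hK : ∀ z, K < ‖z‖ → m < ‖F z‖) : ∃ (C : ℝ) (N : ℕ), ∀ z, ‖(g z)⁻¹‖ ≤ C * (1 + ‖z‖) ^ N := by
  have hinv : Continuous fun z => (g z)⁻¹ := (hg.fun_inv hg0).continuous
  obtain ⟨C, hC, N, hprod⟩ := exists_norm_prod_zpow_le s d
  obtain ⟨M, hM⟩ := (isCompact_closedBall (0 : ℂ) (K + 1)).exists_bound_of_continuousOn
    hinv.continuousOn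
  have hfar : ∀ z : ℂ, K + 1 < ‖z‖ → ‖(g z)⁻¹‖ ≤ C / m * (1 + ‖z‖) ^ N := fun z hz => by
    refine norm_le_of_eventually_codiscrete (B := fun z => C / m * (1 + ‖z‖) ^ N) hinv
      (by fun_prop) (isOpen_lt continuous_const continuous_norm) ?_ hz
    filter_upwards [hFg] with y hy hyK
    have hlower := hK y ((lt_add_one K).trans hyK)
    rw [hy, norm_mul] at hlower
    have hupper := hprod y fun u hu => by
      linarith [hs u hu, norm_sub_norm_le y u, show K + 1 < ‖y‖ from hyK]
    have hgy : 0 < ‖g y‖ := norm_pos_iff.mpr (hg0 y)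
    rw [norm_inv, inv_le_iff_one_le_mul₀ hgy, div_mul_eq_mul_div, div_mul_eq_mul_div,
      one_le_div hm]
    exact hlower.le.trans (mul_le_mul_of_nonneg_right hupper hgy.le)
  refine ⟨C / m + |M|, N, fun z => ?_⟩
  have hpow : 1 ≤ (1 + ‖z‖) ^ N := one_le_pow₀ (by linarith [norm_nonneg z])
  have : 0 ≤ C / m := div_nonneg hC hm.le
  rw [add_mul]
  rcases le_or_gt ‖z‖ (K + 1) with hz | hz
  · calc ‖(g z)⁻¹‖ ≤ |M| := (hM z (mem_closedBall_zero_iff.mpr hz)).trans (le_abs_self M)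
      _ ≤ |M| * (1 + ‖z‖) ^ N := le_mul_of_one_le_right (abs_nonneg M) hpow
      _ ≤ _ := le_add_of_nonneg_left (by positivity)
  · exact (hfar z hz).trans (le_add_of_nonneg_right (by positivity))

theorem isRational_of_lt_norm {F : ℂ → ℂ} (hF : ∀ z, MeromorphicNFAt F z) {m K : ℝ} (hm : 0 < m)
    (hK : ∀ z, K < ‖z‖ → m < ‖F z‖) : IsRational F := by
  obtain ⟨s, d, g, hs, hg, hg0, hFg⟩ := exists_eventually_eq_prod_zpow_mul
    (fun z => (hF z).meromorphicAt) fun z hz =>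
      (hF z).meromorphicOrderAt_eq_zero_iff.mpr (norm_pos_iff.mp (hm.trans (hK z hz)))
  obtain ⟨C, N, hbound⟩ := exists_norm_inv_le_of_lt_norm_mul hm hs hg hg0 hFg hK
  obtain ⟨P, hP⟩ := exists_polynomial_of_norm_le (hg.fun_inv hg0) hbound
  obtain ⟨p, q, hq, hpq⟩ := exists_prod_zpow_eq_div s d
  have hP0 : P ≠ 0 := by
    rintro rfl
    exact hg0 0 (by simpa using hP 0)
  refine ⟨p, q * P, mul_ne_zero hq hP0, ?_⟩
  filter_upwards [hFg] with z hz
  rw [hz, hpq, Polynomial.eval_mul, ← hP z, div_mul_eq_div_div, div_inv_eq_mul]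

/-! ### Logarithmic singularities over infinity -/

theorem log_mem_rightHalfPlane {L : ℝ} {w : ℂ} (hw : Real.exp L < ‖w‖) :
    Complex.log w ∈ rightHalfPlane L := by
  change L < (Complex.log w).re
  rw [Complex.log_re]
  exact (Real.lt_log_iff_exp_lt ((Real.exp_pos L).trans hw)).mpr hw

theorem ne_zero_of_exp_lt_norm {L : ℝ} {w : ℂ} (hw : Real.exp L < ‖w‖) : w ≠ 0 :=
  norm_pos_iff.mp ((Real.exp_pos L).trans hw)

theorem exists_analyticAt_of_tendsto_cocompact {F : ℂ → ℂ} (hF : Meromorphic F) {γ : ℝ → ℂ}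
    {t₀ : ℝ} (hγ : ContinuousOn γ (Ici t₀)) (hγlim : Tendsto γ atTop (cocompact ℂ)) :
    ∃ t ≥ t₀, AnalyticAt ℂ F (γ t) := by
  by_contra! h
  have hcodiscrete : {z | AnalyticAt ℂ F z} ∈ codiscrete ℂ := by
    refine mem_codiscrete.mpr fun z => ?_
    rw [disjoint_principal_right, compl_compl]
    exact (hF z).eventually_analyticAt
  have hconst : ∀ t ∈ Ici t₀, γ t = γ t₀ := fun t ht =>
    isPreconnected_Ici.constant_of_mapsTo (mem_codiscrete'.mp hcodiscrete).2 hγ h ht self_mem_Ici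
  obtain ⟨t, ht, hle⟩ := ((hγlim.eventually
    (isCompact_singleton (x := γ t₀)).compl_mem_cocompact).and (eventually_ge_atTop t₀)).exists
  exact ht (hconst t hle)

theorem UnramifiedAbove.exists_mul_sqrt_le_proximity {F : ℂ → ℂ} {L : ℝ} (hF : UnramifiedAbove F L)
    (hL : 0 ≤ L) (hrat : ¬ IsRational F) {γ : ℝ → ℂ} (hγ : ContinuousOn γ (Ici 0))
    (hγlim : Tendsto γ atTop (cocompact ℂ))
    (hγF : ∀ K, ∀ᶠ t in atTop, K < ‖F (γ t)‖ ∨ ¬ AnalyticAt ℂ F (γ t)) :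
    ∃ c > 0, ∀ᶠ r in atTop, c * √r ≤ ValueDistribution.proximity F ⊤ r := by
  have hsmall : ∀ K, ∃ z, K < ‖z‖ ∧ ‖F z‖ ≤ Real.exp L := by
    by_contra! ⟨K, hK⟩
    exact hrat (isRational_of_lt_norm hF.normalForm (Real.exp_pos L) hK)
  obtain ⟨t₀, ht₀, htail⟩ := ((eventually_ge_atTop (0 : ℝ)).and
    (eventually_forall_ge_atTop.mpr (hγF (Real.exp (L + 1))))).exists
  obtain ⟨t₁, ht₁, han⟩ := exists_analyticAt_of_tendsto_cocompact
    (fun z => (hF.normalForm z).meromorphicAt) (hγ.mono (Ici_subset_Ici.mpr ht₀)) hγlim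
  have hlarge : Real.exp (L + 1) < ‖F (γ t₁)‖ := (htail t₁ ht₁).resolve_right (not_not.mpr han)
  have hlog := log_mem_rightHalfPlane hlarge
  have hL' : L < L + 1 := lt_add_one L
  obtain ⟨ψ, hψ, hψ_log⟩ := hF.exists_isLogInverse (rightHalfPlane_subset hL'.le hlog)
    (Complex.exp_log (ne_zero_of_exp_lt_norm hlarge)).symm
  have hinj : InjOn ψ (rightHalfPlane L) := by
    refine hψ.injOn hF hL' hsmall (γ := fun t => γ (t₁ + t)) ?_ ?_ ?_ ⟨_, hlog, by simp [hψ_log]⟩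
    · exact hγ.comp (by fun_prop) fun t ht => add_nonneg (ht₀.trans ht₁) ht
    · exact hγlim.comp (tendsto_atTop_add_const_left _ _ tendsto_id)
    · exact fun t ht => htail _ (ht₁.trans (le_add_of_nonneg_right ht))
  exact hψ.exists_mul_sqrt_le_proximity hF hinj hL

/-! ### Values in the Riemann sphere -/

theorem sphereMap_eq_coe {f g : ℂ → ℂ} {z : ℂ} (h : f =ᶠ[𝓝[≠] z] g) (hg : ContinuousAt g z) :
    sphereMap f z = (g z : OnePoint ℂ) := by
  refine Tendsto.limUnder_eq (((OnePoint.continuous_coe.tendsto (g z)).comp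
    (hg.tendsto.mono_left nhdsWithin_le_nhds)).congr' ?_)
  filter_upwards [h] with w hw
  simp [hw]

theorem tendsto_coe_cobounded_nhdsNE_infty :
    Tendsto (fun w : ℂ => (w : OnePoint ℂ)) (Bornology.cobounded ℂ) (𝓝[≠] OnePoint.infty) := by
  rw [OnePoint.nhdsNE_infty_eq, coclosedCompact_eq_cocompact, ← cobounded_eq_cocompact]
  exact tendsto_map

theorem tendsto_coe_add_inv_cobounded_nhdsNE (a : ℂ) :
    Tendsto (fun w : ℂ => ((a + w⁻¹ : ℂ) : OnePoint ℂ)) (Bornology.cobounded ℂ)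
      (𝓝[≠] (a : OnePoint ℂ)) := by
  refine tendsto_nhdsWithin_iff.mpr ⟨(OnePoint.continuous_coe.tendsto a).comp ?_, ?_⟩
  · simpa using (tendsto_inv₀_cobounded (α := ℂ)).const_add a
  · filter_upwards [Bornology.eventually_ne_cobounded (0 : ℂ)] with w hw
    simpa using hw

theorem sphereMap_eq_infty {f : ℂ → ℂ} {z : ℂ}
    (h : Tendsto f (𝓝[≠] z) (Bornology.cobounded ℂ)) : sphereMap f z = OnePoint.infty :=
  Tendsto.limUnder_eq
    ((tendsto_coe_cobounded_nhdsNE_infty.mono_right nhdsWithin_le_nhds).comp h)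

theorem isCriticalPoint_of_deriv_eq_zero {f g : ℂ → ℂ} {z : ℂ} (h : f =ᶠ[𝓝[≠] z] g)
    (hg : AnalyticAt ℂ g z) (hderiv : deriv g z = 0) : IsCriticalPoint f z := by
  refine Or.inl ⟨?_, ?_⟩
  · rw [meromorphicOrderAt_congr h]
    exact hg.meromorphicOrderAt_nonneg
  · rw [meromorphicOrderAt_congr h.nhdsNE_deriv,
      ← tendsto_zero_iff_meromorphicOrderAt_pos hg.deriv.meromorphicAt, ← hderiv]
    exact hg.deriv.continuousAt.tendsto.mono_left nhdsWithin_le_nhds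

theorem unramifiedAbove_of_notMem_singularValues {f F M : ℂ → ℂ} {L : ℝ}
    (hF : ∀ z, MeromorphicNFAt F z) (hM : ∀ w ≠ 0, AnalyticAt ℂ M w)
    (hfF : f =ᶠ[codiscrete ℂ] fun z => M (F z))
    (hL : ∀ w : ℂ, Real.exp L < ‖w‖ → (M w : OnePoint ℂ) ∉ singularValues f) :
    UnramifiedAbove F L := by
  have hM_large : ∀ w : ℂ, Real.exp L < ‖w‖ → AnalyticAt ℂ M w := fun w hw =>
    hM w (ne_zero_of_exp_lt_norm hw)
  have hF_large : ∀ z, Real.exp L < ‖F z‖ → AnalyticAt ℂ F z := fun z hz => not_not.mp fun h =>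
    ne_zero_of_exp_lt_norm hz (eq_zero_and_tendsto_of_not_analyticAt (hF z) h).1
  have hMF : ∀ z, Real.exp L < ‖F z‖ → AnalyticAt ℂ (fun z => M (F z)) z := fun z hz =>
    (hM_large _ hz).comp (hF_large z hz)
  have hsphere : ∀ z, Real.exp L < ‖F z‖ → sphereMap f z = (M (F z) : OnePoint ℂ) := fun z hz =>
    sphereMap_eq_coe (eventually_nhdsNE_of_codiscrete hfF z) (hMF z hz).continuousAt
  refine ⟨hF, fun z hz hderiv => hL _ hz (Or.inl ⟨z, ?_, hsphere z hz⟩),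
    fun w γ hw hγ hγlim hlim => hL w hw (Or.inr ⟨γ, hγ, hγlim, ?_⟩)⟩
  · refine isCriticalPoint_of_deriv_eq_zero (eventually_nhdsNE_of_codiscrete hfF z) (hMF z hz) ?_
    simpa [Function.comp_def, hderiv] using
      deriv_comp z (hM_large _ hz).differentiableAt (hF_large z hz).differentiableAt
  · refine ((OnePoint.continuous_coe.tendsto (M w)).comp
      ((hM_large w hw).continuousAt.tendsto.comp hlim)).congr' ?_
    filter_upwards [hlim.norm.eventually_const_lt hw] with t ht
    exact (hsphere _ ht).symm

theorem exists_forall_exp_lt_notMem {X : Type*} [TopologicalSpace X] {M : ℂ → X} {a : X} {S : Set X}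
    (hM : Tendsto M (Bornology.cobounded ℂ) (𝓝[≠] a)) (hS : ∀ᶠ b in 𝓝[≠] a, b ∉ S) :
    ∃ L ≥ 0, ∀ w, Real.exp L < ‖w‖ → M w ∉ S := by
  have hlarge := hM.eventually hS
  rw [← comap_norm_atTop, eventually_comap] at hlarge
  obtain ⟨B, hB⟩ := eventually_atTop.mp hlarge
  refine ⟨|B|, abs_nonneg B, fun w hw => hB ‖w‖ ?_ w rfl⟩
  linarith [le_abs_self B, Real.add_one_le_exp |B|]

theorem exists_mul_sqrt_le_characteristic {f F M : ℂ → ℂ} {a : OnePoint ℂ}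
    (hF : ∀ z, MeromorphicNFAt F z) (hM : ∀ w ≠ 0, AnalyticAt ℂ M w)
    (hMa : Tendsto (fun w => (M w : OnePoint ℂ)) (Bornology.cobounded ℂ) (𝓝[≠] a))
    (hfF : f =ᶠ[codiscrete ℂ] fun z => M (F z)) (hrat : ¬ IsRational F)
    (hisol : ∀ᶠ b in 𝓝[≠] a, b ∉ singularValues f) {γ : ℝ → ℂ} (hγ : ContinuousOn γ (Ici 0))
    (hγlim : Tendsto γ atTop (cocompact ℂ))
    (hγF : ∀ K, ∀ᶠ t in atTop, K < ‖F (γ t)‖ ∨ ¬ AnalyticAt ℂ F (γ t)) :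
    ∃ c > 0, ∀ᶠ r in atTop, c * √r ≤ ValueDistribution.characteristic F ⊤ r := by
  obtain ⟨L, hL, hregular⟩ := exists_forall_exp_lt_notMem hMa hisol
  obtain ⟨c, hc, hproximity⟩ := (unramifiedAbove_of_notMem_singularValues hF hM hfF
    hregular).exists_mul_sqrt_le_proximity hL hrat hγ hγlim hγF
  refine ⟨c, hc, ?_⟩
  filter_upwards [hproximity, eventually_ge_atTop 1] with r hr hr1
  exact hr.trans (le_add_of_nonneg_right (ValueDistribution.logCounting_nonneg hr1))

theorem lowerGrowth_pos {f : ℂ → ℂ} {c C : ℝ} (hc : 0 < c)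
    (h : ∀ᶠ r in atTop, c * √r ≤ ValueDistribution.characteristic f ⊤ r + C) :
    0 < lowerGrowth f := by
  have hc2 : (0 : EReal) < ((c / 2 : ℝ) : EReal) := by exact_mod_cast half_pos hc
  refine hc2.trans_le (le_liminf_of_le (by isBoundedDefault) ?_)
  filter_upwards [h, eventually_gt_atTop 0,
    Real.tendsto_sqrt_atTop.eventually_ge_atTop (2 * |C| / c)] with r hr hr0 hsqrt
  rw [EReal.coe_le_coe_iff, le_div_iff₀ (Real.sqrt_pos.mpr hr0)]
  rw [div_le_iff₀ hc] at hsqrt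
  linarith [le_abs_self C]

/-! ### The asymptotic value infinity -/

theorem eventually_lt_norm_or_not_analyticAt_of_tendsto_infty {ι : Type*} {l : Filter ι}
    {f F : ℂ → ℂ} (hfF : f =ᶠ[codiscrete ℂ] F) {γ : ι → ℂ}
    (hlim : Tendsto (fun t => sphereMap f (γ t)) l (𝓝 OnePoint.infty)) (K : ℝ) :
    ∀ᶠ t in l, K < ‖F (γ t)‖ ∨ ¬ AnalyticAt ℂ F (γ t) := by
  have hnhds : ∀ᶠ b : OnePoint ℂ in 𝓝 OnePoint.infty, ∀ w : ℂ, b = w → K < ‖w‖ := by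
    rw [OnePoint.nhds_infty_eq, eventually_sup, eventually_map, coclosedCompact_eq_cocompact,
      ← cobounded_eq_cocompact, eventually_pure]
    refine ⟨?_, fun w hw => absurd hw (OnePoint.infty_ne_coe w)⟩
    filter_upwards [tendsto_norm_cobounded_atTop.eventually_gt_atTop K] with x hx w hw
    rwa [← OnePoint.coe_injective hw]
  filter_upwards [hlim.eventually hnhds] with t ht
  refine or_not_of_imp fun han => ?_
  exact ht _ (sphereMap_eq_coe (eventually_nhdsNE_of_codiscrete hfF _) han.continuousAt)

theorem lowerGrowth_pos_of_isAsymptoticValue_infty {f : ℂ → ℂ} (hf : Meromorphic f)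
    (hrat : ¬ IsRational f) (ha : IsAsymptoticValue f OnePoint.infty)
    (hisol : ∀ᶠ b in 𝓝[≠] OnePoint.infty, b ∉ singularValues f) : 0 < lowerGrowth f := by
  obtain ⟨γ, hγ, hγlim, hlim⟩ := ha
  have hfF : f =ᶠ[codiscrete ℂ] toMeromorphicNFOn f univ :=
    toMeromorphicNFOn_eqOn_codiscrete hf.meromorphicOn
  obtain ⟨c, hc, hbound⟩ := exists_mul_sqrt_le_characteristic (M := fun w => w)
    (fun z => meromorphicNFOn_toMeromorphicNFOn f univ (mem_univ z)) (fun w _ => analyticAt_id)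
    tendsto_coe_cobounded_nhdsNE_infty hfF
    (fun ⟨p, q, hq, hpq⟩ => hrat ⟨p, q, hq, hfF.trans hpq⟩) hisol hγ hγlim
    (eventually_lt_norm_or_not_analyticAt_of_tendsto_infty hfF hlim)
  refine lowerGrowth_pos (C := 0) hc ?_
  filter_upwards [hbound, eventually_ne_atTop 0] with r hr hr0
  rwa [ValueDistribution.characteristic_congr_codiscrete hfF hr0, add_zero]

theorem exists_lt_norm_of_not_isRational {f : ℂ → ℂ} (hf : Differentiable ℂ f)
    (hrat : ¬ IsRational f) (K : ℝ) : ∃ z, K < ‖f z‖ := by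
  by_contra! h
  refine hrat ⟨Polynomial.C (f 0), 1, one_ne_zero, Eventually.of_forall fun z => ?_⟩
  simp [hf.apply_eq_apply_of_bounded
    (isBounded_iff_forall_norm_le.mpr ⟨K, forall_mem_range.mpr h⟩) z 0]

theorem tendsto_cocompact_of_tendsto_norm_comp {ι : Type*} {l : Filter ι} {f : ℂ → ℂ}
    (hf : Continuous f) {γ : ι → ℂ} (h : Tendsto (fun t => ‖f (γ t)‖) l atTop) :
    Tendsto γ l (cocompact ℂ) := by
  rw [(hasBasis_cocompact (X := ℂ)).tendsto_right_iff]
  intro K hK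
  obtain ⟨B, hB⟩ := hK.exists_bound_of_continuousOn hf.continuousOn
  filter_upwards [h.eventually_gt_atTop B] with t ht htK
  exact (hB _ htK).not_gt ht

theorem IsLogInverse.isAsymptoticValue_infty {f ψ : ℂ → ℂ} {L : ℝ} (hψ : IsLogInverse f L ψ)
    (hf : Continuous f) : IsAsymptoticValue f OnePoint.infty := by
  let ray : ℝ → ℂ := fun t => ((L + 1 : ℝ) : ℂ) + t
  have hray : MapsTo ray (Ici 0) (rightHalfPlane L) := fun t ht => by
    have ht0 : 0 ≤ t := ht
    simp only [ray, rightHalfPlane, mem_ofPred_eq, Complex.add_re, Complex.ofReal_re]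
    linarith
  have hnorm : Tendsto (fun t => ‖f (ψ (ray t))‖) atTop atTop := by
    refine (Real.tendsto_exp_atTop.comp
      (tendsto_atTop_add_const_left atTop (L + 1) tendsto_id)).congr' ?_
    filter_upwards [eventually_ge_atTop 0] with t ht
    rw [hψ.map_eq _ (hray ht), Complex.norm_exp]
    simp [ray]
  refine ⟨fun t => ψ (ray t), hψ.continuousOn.comp (by fun_prop) hray,
    tendsto_cocompact_of_tendsto_norm_comp hf hnorm, ?_⟩
  simp only [sphereMap_eq_coe EventuallyEq.rfl hf.continuousAt]
  exact (tendsto_coe_cobounded_nhdsNE_infty.mono_right nhdsWithin_le_nhds).comp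
    (tendsto_norm_atTop_iff_cobounded.mp hnorm)

theorem isAsymptoticValue_infty_of_differentiable {f : ℂ → ℂ} (hf : Differentiable ℂ f)
    (hrat : ¬ IsRational f) (hisol : ∀ᶠ b in 𝓝[≠] OnePoint.infty, b ∉ singularValues f) :
    IsAsymptoticValue f OnePoint.infty := by
  obtain ⟨L, -, hregular⟩ := exists_forall_exp_lt_notMem tendsto_coe_cobounded_nhdsNE_infty hisol
  have hunram : UnramifiedAbove f L := unramifiedAbove_of_notMem_singularValues (M := fun w => w)
    (fun z => (hf.analyticAt z).meromorphicNFAt) (fun w _ => analyticAt_id) EventuallyEq.rfl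
    hregular
  obtain ⟨z₀, hz₀⟩ := exists_lt_norm_of_not_isRational hf hrat (Real.exp L)
  obtain ⟨ψ, hψ, -⟩ := hunram.exists_isLogInverse (log_mem_rightHalfPlane hz₀)
    (Complex.exp_log (ne_zero_of_exp_lt_norm hz₀)).symm
  exact hψ.isAsymptoticValue_infty hf.continuous

/-! ### Finite asymptotic values -/

theorem eval_ne_zero_codiscrete {p : Polynomial ℂ} (hp : p ≠ 0) :
    ∀ᶠ z in codiscrete ℂ, p.eval z ≠ 0 := by
  obtain ⟨x, hx⟩ : ∃ x, p.eval x ≠ 0 := by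
    by_contra! h
    exact hp (Polynomial.funext fun x => by simpa using h x)
  exact AnalyticOnNhd.preimage_zero_mem_codiscrete (f := fun z => p.eval z)
    (fun z _ => p.differentiable.analyticAt z) hx

theorem isRational_of_eventuallyEq_add_inv {f F : ℂ → ℂ} {a : ℂ} (hF : IsRational F)
    (hfF : f =ᶠ[codiscrete ℂ] fun z => a + (F z)⁻¹) : IsRational f := by
  obtain ⟨p, q, -, hpq⟩ := hF
  rcases eq_or_ne p 0 with rfl | hp
  · refine ⟨Polynomial.C a, 1, one_ne_zero, ?_⟩
    filter_upwards [hfF, hpq] with z hfz hFz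
    simp [hfz, hFz]
  · refine ⟨Polynomial.C a * p + q, p, hp, ?_⟩
    filter_upwards [hfF, hpq, eval_ne_zero_codiscrete hp] with z hfz hFz hpz
    simp only [hfz, hFz, Polynomial.eval_add, Polynomial.eval_mul, Polynomial.eval_C]
    field_simp

theorem meromorphicOrderAt_ne_top_of_not_isRational {F : ℂ → ℂ} (hF : Meromorphic F)
    (hrat : ¬ IsRational F) (z : ℂ) : meromorphicOrderAt F z ≠ ⊤ := by
  suffices h : ∀ u : (univ : Set ℂ), meromorphicOrderAt F u ≠ ⊤ from h ⟨z, mem_univ z⟩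
  rw [← hF.meromorphicOn.exists_meromorphicOrderAt_ne_top_iff_forall isConnected_univ]
  by_contra! h
  have hzero : {z | F z = 0} ∈ codiscrete ℂ := by
    refine mem_codiscrete.mpr fun z => ?_
    rw [disjoint_principal_right, compl_compl]
    exact meromorphicOrderAt_eq_top_iff.mp (h ⟨z, mem_univ z⟩)
  exact hrat ⟨0, 1, one_ne_zero, by filter_upwards [hzero] with z hz; simpa using hz⟩

theorem sphereMap_eq_infty_of_eq_zero {f F : ℂ → ℂ} {a z : ℂ}
    (hfF : f =ᶠ[codiscrete ℂ] fun z => a + (F z)⁻¹) (han : AnalyticAt ℂ F z) (hFz : F z = 0)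
    (horder : meromorphicOrderAt F z ≠ ⊤) : sphereMap f z = OnePoint.infty := by
  have hzero : Tendsto F (𝓝[≠] z) (𝓝[≠] 0) := tendsto_nhdsWithin_iff.mpr
    ⟨hFz ▸ han.continuousAt.tendsto.mono_left nhdsWithin_le_nhds,
      (meromorphicOrderAt_ne_top_iff_eventually_ne_zero han.meromorphicAt).mp horder⟩
  refine sphereMap_eq_infty (((tendsto_const_add_cobounded a).comp
    (tendsto_inv₀_nhdsNE_zero.comp hzero)).congr' ?_)
  filter_upwards [eventually_nhdsNE_of_codiscrete hfF z] with y hy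
  simp [hy]

theorem eventually_lt_norm_or_not_analyticAt_of_tendsto_coe {ι : Type*} {l : Filter ι}
    {f F : ℂ → ℂ} {a : ℂ} (hfF : f =ᶠ[codiscrete ℂ] fun z => a + (F z)⁻¹)
    (horder : ∀ z, meromorphicOrderAt F z ≠ ⊤) {γ : ι → ℂ}
    (hlim : Tendsto (fun t => sphereMap f (γ t)) l (𝓝 (a : OnePoint ℂ))) (K : ℝ) :
    ∀ᶠ t in l, K < ‖F (γ t)‖ ∨ ¬ AnalyticAt ℂ F (γ t) := by
  have hnhds : ∀ᶠ b in 𝓝 (a : OnePoint ℂ), b ≠ OnePoint.infty ∧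
      ∀ w : ℂ, w ≠ 0 → b = ((a + w⁻¹ : ℂ) : OnePoint ℂ) → K < ‖w‖ := by
    rw [OnePoint.nhds_coe_eq, eventually_map]
    have hK : 0 < (|K| + 1)⁻¹ := by positivity
    filter_upwards [ball_mem_nhds a hK] with x hx
    refine ⟨OnePoint.coe_ne_infty x, fun w hw hxw => ?_⟩
    rw [OnePoint.coe_injective hxw, mem_ball, dist_eq_norm, add_sub_cancel_left, norm_inv,
      inv_lt_inv₀ (norm_pos_iff.mpr hw) (by positivity)] at hx
    linarith [le_abs_self K]
  filter_upwards [hlim.eventually hnhds] with t ⟨hfinite, hlarge⟩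
  refine or_not_of_imp fun han => ?_
  have hne : F (γ t) ≠ 0 := fun hFz =>
    hfinite (sphereMap_eq_infty_of_eq_zero hfF han hFz (horder _))
  exact hlarge _ hne (sphereMap_eq_coe (eventually_nhdsNE_of_codiscrete hfF _)
    (continuousAt_const.add (han.continuousAt.inv₀ hne)))

theorem exists_characteristic_inv_sub_const_le {f : ℂ → ℂ} (hf : Meromorphic f) (a : ℂ) :
    ∃ C, ∀ r, ValueDistribution.characteristic (fun z => f z - a)⁻¹ ⊤ r ≤
      ValueDistribution.characteristic f ⊤ r + C := by
  have hfa : Meromorphic fun z => f z - a := fun z => (hf z).fun_sub (MeromorphicAt.const a z)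
  obtain ⟨C₁, hinv⟩ : ∃ C₁, ∀ r, |ValueDistribution.characteristic (fun z => f z - a) ⊤ r -
      ValueDistribution.characteristic (fun z => f z - a)⁻¹ ⊤ r| ≤ C₁ :=
    ⟨_, fun r => ValueDistribution.characteristic_sub_characteristic_inv_le hfa⟩
  obtain ⟨C₂, hshift⟩ : ∃ C₂, ∀ r, |ValueDistribution.characteristic f ⊤ r -
      ValueDistribution.characteristic (fun z => f z - a) ⊤ r| ≤ C₂ :=
    ⟨_, fun r => ValueDistribution.abs_characteristic_sub_characteristic_shift_le hf⟩
  exact ⟨C₁ + C₂, fun r => by linarith [(abs_le.mp (hinv r)).1, (abs_le.mp (hshift r)).1]⟩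

theorem lowerGrowth_pos_of_isAsymptoticValue_coe {f : ℂ → ℂ} (hf : Meromorphic f)
    (hrat : ¬ IsRational f) {a : ℂ} (ha : IsAsymptoticValue f a)
    (hisol : ∀ᶠ b in 𝓝[≠] (a : OnePoint ℂ), b ∉ singularValues f) : 0 < lowerGrowth f := by
  obtain ⟨γ, hγ, hγlim, hlim⟩ := ha
  have hG : MeromorphicOn (fun z => f z - a)⁻¹ univ := fun z _ =>
    ((hf z).fun_sub (MeromorphicAt.const a z)).inv
  set F := toMeromorphicNFOn (fun z => f z - a)⁻¹ univ
  have hF : ∀ z, MeromorphicNFAt F z := fun z =>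
    meromorphicNFOn_toMeromorphicNFOn _ univ (mem_univ z)
  have hGF : (fun z => f z - a)⁻¹ =ᶠ[codiscrete ℂ] F := toMeromorphicNFOn_eqOn_codiscrete hG
  have hfF : f =ᶠ[codiscrete ℂ] fun z => a + (F z)⁻¹ := by
    filter_upwards [hGF] with z hz
    simp [← hz]
  have hFrat : ¬ IsRational F := fun h => hrat (isRational_of_eventuallyEq_add_inv h hfF)
  have horder := meromorphicOrderAt_ne_top_of_not_isRational (fun z => (hF z).meromorphicAt) hFrat
  obtain ⟨c, hc, hbound⟩ := exists_mul_sqrt_le_characteristic (M := fun w => a + w⁻¹) hF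
    (fun w hw => analyticAt_const.add (analyticAt_id.inv hw))
    (tendsto_coe_add_inv_cobounded_nhdsNE a) hfF hFrat hisol hγ hγlim
    (eventually_lt_norm_or_not_analyticAt_of_tendsto_coe hfF horder hlim)
  obtain ⟨C, hC⟩ := exists_characteristic_inv_sub_const_le hf a
  refine lowerGrowth_pos (C := C) hc ?_
  filter_upwards [hbound, eventually_ne_atTop 0] with r hr hr0
  rw [← ValueDistribution.characteristic_congr_codiscrete hGF hr0] at hr
  exact hr.trans (hC r)

end SingularValues

theorem mainTheorem4_general :
    (∀ f : ℂ → ℂ, SingularValues.IsTranscendentalMeromorphic f →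
      ∀ a : OnePoint ℂ, SingularValues.IsAsymptoticValue f a →
      (∀ᶠ b in 𝓝[≠] a, b ∉ SingularValues.singularValues f) →
      0 < SingularValues.lowerGrowth f) ∧
    (∀ f : ℂ → ℂ, Differentiable ℂ f → ¬ SingularValues.IsRational f →
      (∀ᶠ b in 𝓝[≠] OnePoint.infty, b ∉ SingularValues.singularValues f) →
      0 < SingularValues.lowerGrowth f) := by
  refine ⟨fun f ⟨hf, hrat⟩ a ha hisol => ?_, fun f hf hrat hisol => ?_⟩
  · induction a using OnePoint.rec with
    | infty => exact SingularValues.lowerGrowth_pos_of_isAsymptoticValue_infty hf hrat ha hisol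
    | coe a => exact SingularValues.lowerGrowth_pos_of_isAsymptoticValue_coe hf hrat ha hisol
  · exact SingularValues.lowerGrowth_pos_of_isAsymptoticValue_infty
      (fun z => (hf.analyticAt z).meromorphicAt) hrat
      (SingularValues.isAsymptoticValue_infty_of_differentiable hf hrat hisol) hisol

theorem mainTheorem4 :
    (∀ f : ℂ → ℂ, SingularValues.IsTranscendentalMeromorphic f →
      (SingularValues.singularValues f).Finite →
      (∃ a : OnePoint ℂ, SingularValues.IsAsymptoticValue f a) →
      0 < SingularValues.lowerGrowth f) ∧
    (∀ f : ℂ → ℂ, Differentiable ℂ f → ¬ SingularValues.IsRational f →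
      (SingularValues.singularValues f).Finite →
      0 < SingularValues.lowerGrowth f) :=
  ⟨fun f hf hfin ⟨a, ha⟩ => mainTheorem4_general.1 f hf a ha
      (nhdsNE_le_cofinite a hfin.compl_mem_cofinite),
    fun f hf hrat hfin => mainTheorem4_general.2 f hf hrat
      (nhdsNE_le_cofinite _ hfin.compl_mem_cofinite)⟩
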